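/- Let $n\ge 1$ and let $\mathfrak S_m$ be the symmetric group on $\{1,\dots,m\}$, with products read as compositions of maps; let $s_i\in\mathfrak S_{n+1}$ be the transposition of $i$ and $i+1$, and $s(n,1)=s_ns_{n-1}\cdots s_1$. The Bruhat order is: $v\le w$ if a reduced decomposition of $v$ is a subword of some reduced decomposition of $w$. For $v\le w$ in $\mathfrak S_{n+1}$, the Bruhat interval polytope is $$Q_{v,w}=\operatorname{Conv}\{(z(1),\dots,z(n+1))\in\mathbb R^{n+1}\mid v\le z\le w\}.$$ For $u\in\mathfrak S_n$ let $t(u)\in\mathfrak S_{n+1}$ be given by $t(u)(i)=u(i)$ for $i\le n$ and $t(u)(n+1)=n+1$, and let $w_0\in\mathfrak S_n$ be the longest element, $w_0(i)=n+1-i$. Let $N=\mathbb Z^{n+1}/\mathbb Z(1,\dots,1)$, which is dual, through the dot product, to the lattice of integer vectors with coordinate sum $0$, and let $\varpi_i\in N$ be the class of $e_1+\dots+e_i$ for $0\le i\le n+1$ (so $\varpi_0=\varpi_{n+1}=0$). The normal fan of a polytope $P\subset\mathbb R^{n+1}$ that lies in a hyperplane of constant coordinate sum is the set of the cones $\{y\in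 N\otimes\mathbb R\mid \langle y,p-f\rangle\ge 0 \text{ for all } p\in P,\ f\in F\}$, where $F$ runs over the nonempty faces of $P$. A triangulation $T$ of the convex $(n+2)$-gon with vertices $0,1,\dots,n+1$ in counterclockwise order is identified with the set of the edges of its $n$ triangles. Starting with the edge $e=\{0,n+1\}$, take the triangle $a<c<b$ of $T$ with the edge $e=\{a,b\}$ as its longest side (so $c$ lies between $a$ and $b$), call $\{a,c\}$ a left edge and $\{c,b\}$ a right edge, and repeat this with $\{a,c\}$ and with $\{c,b\}$ in place of $e$ until only sides of the polygon are left. For each $1\le k\le n$ there is exactly one left edge $\{k_L,k\}$ with $k_L<k$ and exactly one right edge $\{k,k_R\}$ with $k<k_R$. Put $\mathbf v_k=\varpi_k-\varpi_{k_R}$ and $\mathbf w_k=\varpi_{k_L}-\varpi_k$. The fan $\Sigma_T$ in $N\otimes\mathbb R$ consists of the cones $\operatorname{Cone}(Q)$, where $Q$ runs over the subsets of $\{\mathbf v_k,\mathbf w_k\mid 1\le k\le n\}$ with $\{\mathbf v_i,\mathbf w_i\}\not\subset Q$ for all $i$. The binary tree of a finite sequence of distinct numbers is empty for the empty sequence;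 otherwise its root stands for the smallest entry, and its left and right subtrees are the binary trees of the entries before and after that entry. For $u\in\mathfrak S_n$ let $\psi(u)$ be the triangulation of the $(n+2)$-gon that corresponds to the binary tree of $u(1),\dots,u(n)$: the root corresponds to the triangle $0<c<n+1$ for which the polygon with vertices $0,\dots,c$ is triangulated according to the left subtree (with $c-1$ vertices), and the polygon with vertices $c,\dots,n+1$ according to the right subtree, recursively. Two fans with respect to lattices $L$ and $L'$ are isomorphic if the linear extension of some isomorphism of lattices $L\to L'$ maps the cones of the one bijectively to the cones of the other. **Theorem.** For every $u\in\mathfrak S_n$, the normal fan of the Bruhat interval polytope $Q_{t(u),\,t(u)s(n,1)}$ is isomorphic, with respect to the lattice $N$, to the fan $\Sigma_{\psi(w_0uw_0)}$. -/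

import Mathlib

open scoped Pointwise

namespace CatalanFan

/-! ### Symmetric groups and the Bruhat order

The symmetric group on `m` letters is `Equiv.Perm (Fin m)`: the letter `i` of the usual
`1`-based notation is the element `i - 1` of `Fin m`. Products are compositions of maps. -/

/-- The simple transposition `s_i` of the symmetric group on `n + 1` letters. -/
def simpleTransposition {n : ℕ} (i : Fin n) : Equiv.Perm (Fin (n + 1)) :=
  Equiv.swap i.castSucc i.succ

/-- The product `s_{i_1} ⋯ s_{i_l}` of a word `i_1, …, i_l`. -/
def wordProd {n : ℕ} (ω : List (Fin n)) : Equiv.Perm (Fin (n + 1)) :=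
  (ω.map simpleTransposition).prod

/-- `ω` is a reduced decomposition of `w`: its product is `w`, and no word with product `w`
is shorter. -/
def IsReducedWord {n : ℕ} (ω : List (Fin n)) (w : Equiv.Perm (Fin (n + 1))) : Prop :=
  wordProd ω = w ∧ ∀ ω' : List (Fin n), wordProd ω' = w → ω.length ≤ ω'.length

/-- The Bruhat order: `v ≤ w` if a reduced decomposition of `v` is a (not necessarily
contiguous) subword of some reduced decomposition of `w`. -/
def BruhatLE {n : ℕ} (v w : Equiv.Perm (Fin (n + 1))) : Prop :=
  ∃ ω' ω : List (Fin n), IsReducedWord ω' v ∧ IsReducedWord ω w ∧ ω'.Sublist ω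

/-- The permutation `u(1) u(2) ⋯ u(n) (n+1)` obtained from `u` by putting the new largest
letter at the tail of the one-line notation. -/
def addTail {n : ℕ} (u : Equiv.Perm (Fin n)) : Equiv.Perm (Fin (n + 1)) :=
  (finSuccEquivLast.trans u.optionCongr).trans finSuccEquivLast.symm

theorem addTail_castSucc {n : ℕ} (u : Equiv.Perm (Fin n)) (i : Fin n) :
    addTail u i.castSucc = (u i).castSucc := by
  simp [addTail]

theorem addTail_last {n : ℕ} (u : Equiv.Perm (Fin n)) :
    addTail u (Fin.last n) = Fin.last n := by
  simp [addTail]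

/-- `s(n,1) = s_n s_{n-1} ⋯ s_1`. -/
def sDown (n : ℕ) : Equiv.Perm (Fin (n + 1)) :=
  wordProd (List.finRange n).reverse

/-! ### Bruhat interval polytopes -/

/-- The point `(z(1), …, z(n+1))` of `ℝ^{n+1}`. -/
def permPoint {n : ℕ} (z : Equiv.Perm (Fin (n + 1))) : Fin (n + 1) → ℝ :=
  fun i => ((z i : ℕ) : ℝ) + 1

/-- The Bruhat interval polytope `Q_{v,w}`. -/
def bruhatIntervalPolytope {n : ℕ} (v w : Equiv.Perm (Fin (n + 1))) :
    Set (Fin (n + 1) → ℝ) :=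
  convexHull ℝ (permPoint '' {z | BruhatLE v z ∧ BruhatLE z w})

/-! ### The lattice `N = ℤ^{n+1} / ℤ(1,…,1)` -/

/-- The line `ℝ(1,…,1)` in `ℝ^{n+1}`. -/
def diagonalLine (n : ℕ) : Submodule ℝ (Fin (n + 1) → ℝ) :=
  Submodule.span ℝ {fun _ => 1}

/-- The real vector space `N ⊗ ℝ = ℝ^{n+1} / ℝ(1,…,1)`, the dual of the space of vectors in
`ℝ^{n+1}` with coordinate sum `0`. -/
abbrev NReal (n : ℕ) : Type := (Fin (n + 1) → ℝ) ⧸ diagonalLine n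

/-- The lattice `N = ℤ^{n+1} / ℤ(1,…,1)` inside `N ⊗ ℝ`: the classes of the integer vectors. -/
def latticeN (n : ℕ) : AddSubgroup (NReal n) :=
  ((Int.castAddHom ℝ).compLeft (Fin (n + 1))).range.map (diagonalLine n).mkQ.toAddMonoidHom

/-- `ϖ_i ∈ N`, the class of `e_1 + ⋯ + e_i`. -/
def varpi (n i : ℕ) : NReal n :=
  (diagonalLine n).mkQ fun j => if (j : ℕ) < i then 1 else 0

/-! ### Normal fans and isomorphisms of fans -/

/-- The (inner) normal cone of a face `F` of a polytope `P ⊆ ℝ^{n+1}` that lies in a hyperplane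
of constant coordinate sum, as a cone in `N ⊗ ℝ`: the classes of those `y` with
`⟨y, p⟩ ≥ ⟨y, f⟩` for all `p ∈ P`, `f ∈ F`. -/
noncomputable def normalCone {n : ℕ} (P F : Set (Fin (n + 1) → ℝ)) : PointedCone ℝ (NReal n) :=
  PointedCone.map (diagonalLine n).mkQ (PointedCone.dual (dotProductBilin ℝ ℝ) (P - F))

/-- The normal fan of a polytope: the set of the normal cones of its nonempty faces. -/
noncomputable def normalFan {n : ℕ} (P : Set (Fin (n + 1) → ℝ)) :
    Set (PointedCone ℝ (NReal n)) :=
  {σ | ∃ F : Set (Fin (n + 1) → ℝ), F.Nonempty ∧ IsExposed ℝ P F ∧ σ = normalCone P F}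

/-- Two fans `Σ` and `Σ'`, in the real vector spaces `V`, `V'` and with respect to the lattices
`L ⊆ V`, `L' ⊆ V'`, are isomorphic: the linear extension `Φ : V → V'` of some isomorphism of
lattices `L → L'` maps the cones of `Σ` bijectively to the cones of `Σ'`. -/
def FanIsomorphic {V V' : Type} [AddCommGroup V] [Module ℝ V] [AddCommGroup V'] [Module ℝ V']
    (L : AddSubgroup V) (S : Set (PointedCone ℝ V))
    (L' : AddSubgroup V') (S' : Set (PointedCone ℝ V')) : Prop :=
  ∃ Φ : V ≃ₗ[ℝ] V', L.map (Φ : V →ₗ[ℝ] V').toAddMonoidHom = L' ∧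
    Set.BijOn (PointedCone.map (Φ : V →ₗ[ℝ] V')) S S'

/-! ### Triangulations of polygons -/

/-- A triangulation of the convex `(n+2)`-gon with vertices `0, 1, …, n+1` in counterclockwise
order, as the set of the edges of its triangles. An edge with end points `a < b` is the pair
`(a, b)`. The set contains all sides of the polygon, no two of its members cross, and it has
`(n + 2) + (n - 1) = 2 n + 1` elements (for `n = 0` the polygon degenerates to one edge). -/
structure Triangulation (n : ℕ) where
  edges : Finset (ℕ × ℕ)
  isEdge : ∀ e ∈ edges, e.1 < e.2 ∧ e.2 ≤ n + 1
  side_mem : ∀ i ≤ n, (i, i + 1) ∈ edges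
  distinguished_mem : (0, n + 1) ∈ edges
  noncrossing : ∀ e ∈ edges, ∀ f ∈ edges, ¬ (e.1 < f.1 ∧ f.1 < e.2 ∧ e.2 < f.2)
  card_eq : edges.card = 2 * n + 1

namespace Triangulation

variable {n : ℕ} (T : Triangulation n)

/-- `a < c < b` are the vertices of a triangle of `T`. -/
def IsTriangle (a c b : ℕ) : Prop :=
  a < c ∧ c < b ∧ (a, c) ∈ T.edges ∧ (c, b) ∈ T.edges ∧ (a, b) ∈ T.edges

/-- The edges met by the recursive process which starts at the distinguished edge
`e = {0, n+1}`. At an edge `e = {a, b}` one takes the triangle with vertices `a < c < b`; its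
other edges, in counterclockwise order `f_L(e), f_R(e), e`, are `f_L(e) = {a, c}` and
`f_R(e) = {c, b}`; then the process continues at `f_L(e)` and `f_R(e)`. -/
inductive Reached : ℕ → ℕ → Prop
  | root : Reached 0 (n + 1)
  | left {a c b : ℕ} : Reached a b → T.IsTriangle a c b → Reached a c
  | right {a c b : ℕ} : Reached a b → T.IsTriangle a c b → Reached c b

/-- `{a, c}` with `a < c` is an edge of the left tree: it is `f_L(e)` for some `e`. -/
def IsLeftEdge (a c : ℕ) : Prop := ∃ b, T.Reached a b ∧ T.IsTriangle a c b

/-- `{c, b}` with `c < b` is an edge of the right tree: it is `f_R(e)` for some `e`. -/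
def IsRightEdge (c b : ℕ) : Prop := ∃ a, T.Reached a b ∧ T.IsTriangle a c b

/-- `k_L`: for `1 ≤ k ≤ n`, the only `a` such that `{a, k}`, `a < k`, is in the left tree. -/
noncomputable def leftNbr (k : ℕ) : ℕ := sInf {a | T.IsLeftEdge a k}

/-- `k_R`: for `1 ≤ k ≤ n`, the only `b` such that `{k, b}`, `k < b`, is in the right tree. -/
noncomputable def rightNbr (k : ℕ) : ℕ := sInf {b | T.IsRightEdge k b}

/-- The vector `v_k = ϖ_k - ϖ_{k_R}`. -/
noncomputable def vVec (k : ℕ) : NReal n := varpi n k - varpi n (T.rightNbr k)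

/-- The vector `w_k = ϖ_{k_L} - ϖ_k`. -/
noncomputable def wVec (k : ℕ) : NReal n := varpi n (T.leftNbr k) - varpi n k

/-- The fan `Σ_T`: its cones are spanned by the subsets `Q` of `{v_k, w_k | 1 ≤ k ≤ n}` which
contain `{v_i, w_i}` for no `i`. -/
noncomputable def fan : Set (PointedCone ℝ (NReal n)) :=
  {σ | ∃ Q : Set (NReal n),
    (∀ y ∈ Q, ∃ k ∈ Finset.Icc 1 n, y = T.vVec k ∨ y = T.wVec k) ∧
    (∀ i ∈ Finset.Icc 1 n, ¬ (T.vVec i ∈ Q ∧ T.wVec i ∈ Q)) ∧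
    σ = PointedCone.hull ℝ Q}

/-- The binary tree of the part of `T` that is cut off by the edge `{a, b}`, `a < b` (the
polygon with vertices `a, a + 1, …, b`). It is empty if `b = a + 1`. Otherwise the root is the
triangle `a < c < b` of `T`, and the left and right subtrees belong to `{a, c}` and `{c, b}`. -/
inductive HasTree : ℕ → ℕ → BinaryTree Unit → Prop
  | nil (a : ℕ) : HasTree a (a + 1) .nil
  | node {a c b : ℕ} {l r : BinaryTree Unit} : T.IsTriangle a c b →
      HasTree a c l → HasTree c b r → HasTree a b (.node () l r)

end Triangulation

/-- The edges of the triangulation, with binary tree `t`, of the polygon with vertices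
`a, a + 1, …, a + m + 1`, where `m` is the number of vertices of `t`. The triangle that
corresponds to the root has the vertices `a < c < a + m + 1`, where `c - a - 1` is the number of
vertices of the left subtree. -/
def treeEdges : BinaryTree Unit → ℕ → Finset (ℕ × ℕ)
  | .nil, a => {(a, a + 1)}
  | .node _ l r, a =>
      insert (a, a + (l.numNodes + r.numNodes + 1) + 1)
        (treeEdges l a ∪ treeEdges r (a + l.numNodes + 1))

theorem treeEdges_bounds (t : BinaryTree Unit) (a : ℕ) :
    ∀ e ∈ treeEdges t a, a ≤ e.1 ∧ e.1 < e.2 ∧ e.2 ≤ a + t.numNodes + 1 := by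
  induction t generalizing a with
  | nil => simp [treeEdges]
  | node x l r hl hr =>
    intro e he
    simp only [treeEdges, Finset.mem_insert, Finset.mem_union, BinaryTree.numNodes] at he ⊢
    rcases he with rfl | he | he
    · simp only; omega
    · have := hl a e he; omega
    · have := hr _ e he; omega

theorem treeEdges_base (t : BinaryTree Unit) (a : ℕ) :
    (a, a + t.numNodes + 1) ∈ treeEdges t a := by
  cases t <;> simp [treeEdges, add_assoc]

theorem treeEdges_side (t : BinaryTree Unit) (a : ℕ) :
    ∀ i, a ≤ i → i ≤ a + t.numNodes → (i, i + 1) ∈ treeEdges t a := by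
  induction t generalizing a with
  | nil => intro i h1 h2; simp [treeEdges] at h2 ⊢; omega
  | node x l r hl hr =>
    intro i h1 h2
    simp only [treeEdges, Finset.mem_insert, Finset.mem_union, BinaryTree.numNodes] at h2 ⊢
    by_cases h : i ≤ a + l.numNodes
    · exact Or.inr (Or.inl (hl a i h1 h))
    · exact Or.inr (Or.inr (hr _ i (by omega) (by omega)))

theorem treeEdges_noncrossing (t : BinaryTree Unit) (a : ℕ) :
    ∀ e ∈ treeEdges t a, ∀ f ∈ treeEdges t a, ¬ (e.1 < f.1 ∧ f.1 < e.2 ∧ e.2 < f.2) := by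
  induction t generalizing a with
  | nil =>
    intro e he f hf
    simp only [treeEdges, Finset.mem_singleton] at he hf
    subst he hf
    simp
  | node x l r hl hr =>
    intro e he f hf
    simp only [treeEdges, Finset.mem_insert, Finset.mem_union] at he hf
    rcases he with rfl | he | he <;> rcases hf with rfl | hf | hf
    · simp
    · have := treeEdges_bounds l a f hf; simp only; omega
    · have := treeEdges_bounds r _ f hf; simp only; omega
    · have := treeEdges_bounds l a e he; simp only; omega
    · exact hl a e he f hf
    · have := treeEdges_bounds l a e he
      have := treeEdges_bounds r _ f hf; omega
    · have := treeEdges_bounds r _ e he; simp only; omega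
    · have := treeEdges_bounds r _ e he
      have := treeEdges_bounds l a f hf; omega
    · exact hr _ e he f hf

theorem treeEdges_card (t : BinaryTree Unit) (a : ℕ) :
    (treeEdges t a).card = 2 * t.numNodes + 1 := by
  induction t generalizing a with
  | nil => simp [treeEdges]
  | node x l r hl hr =>
    rw [treeEdges, Finset.card_insert_of_notMem, Finset.card_union_of_disjoint, hl, hr]
    · simp only [BinaryTree.numNodes]; omega
    · rw [Finset.disjoint_left]
      intro e he he'
      have := treeEdges_bounds l a e he
      have := treeEdges_bounds r _ e he'
      omega
    · intro he
      rcases Finset.mem_union.1 he with he | he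
      · have := treeEdges_bounds l a _ he; simp only at this; omega
      · have := treeEdges_bounds r _ _ he; simp only at this; omega

/-- The triangulation of the `(n+2)`-gon that corresponds to a binary tree with `n` vertices. -/
def Triangulation.ofTree {n : ℕ} (t : BinaryTree Unit) (ht : t.numNodes = n) :
    Triangulation n where
  edges := treeEdges t 0
  isEdge e he := by have := treeEdges_bounds t 0 e he; omega
  side_mem i hi := treeEdges_side t 0 i (by omega) (by omega)
  distinguished_mem := by simpa [ht] using treeEdges_base t 0
  noncrossing := treeEdges_noncrossing t 0
  card_eq := by rw [treeEdges_card, ht]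

/-- The binary tree of `Triangulation.ofTree t` is `t`. -/
theorem Triangulation.ofTree_hasTree {n : ℕ} (t : BinaryTree Unit) (ht : t.numNodes = n) :
    (Triangulation.ofTree t ht).HasTree 0 (n + 1) t := by
  suffices h : ∀ (s : BinaryTree Unit) (a : ℕ), treeEdges s a ⊆ treeEdges t 0 →
      (Triangulation.ofTree t ht).HasTree a (a + s.numNodes + 1) s by
    simpa [ht] using h t 0 subset_rfl
  intro s
  induction s with
  | nil => exact fun a _ => .nil a
  | node x l r hl hr =>
    intro a h
    have h1 : treeEdges l a ⊆ treeEdges t 0 := fun e he =>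
      h (by simp [treeEdges, he])
    have h2 : treeEdges r (a + l.numNodes + 1) ⊆ treeEdges t 0 := fun e he =>
      h (by simp [treeEdges, he])
    have e : a + (BinaryTree.node x l r).numNodes + 1
        = a + l.numNodes + 1 + r.numNodes + 1 := by simp only [BinaryTree.numNodes]; omega
    have h3 := h (treeEdges_base (.node x l r) a)
    rw [e] at h3 ⊢
    exact .node ⟨by omega, by omega, h1 (treeEdges_base l a), h2 (treeEdges_base r _), h3⟩
      (hl a h1) (hr _ h2)

/-! ### The map `ψ` -/

/-- The binary tree of a sequence of distinct numbers: the root is the smallest entry, and the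
left and right subtrees are the trees of the entries before it and of the entries after it. -/
def minTree (l : List ℕ) : BinaryTree Unit :=
  if h : l = [] then .nil
  else .node () (minTree (l.take (l.idxOf (l.min h)))) (minTree (l.drop (l.idxOf (l.min h) + 1)))
termination_by l.length
decreasing_by
  · have := List.idxOf_lt_length_of_mem (List.min_mem h)
    simp only [List.length_take]; omega
  · have := List.idxOf_lt_length_of_mem (List.min_mem h)
    simp only [List.length_drop]; omega

theorem numNodes_minTree (l : List ℕ) : (minTree l).numNodes = l.length := by
  induction h : l.length using Nat.strong_induction_on generalizing l with
  | _ m ih =>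
    rw [minTree]
    split_ifs with hl
    · subst hl; simpa using h
    · have := List.idxOf_lt_length_of_mem (List.min_mem hl)
      simp only [BinaryTree.numNodes]
      rw [ih _ (by simp only [List.length_take]; omega) _ rfl,
        ih _ (by simp only [List.length_drop]; omega) _ rfl]
      simp only [List.length_take, List.length_drop]
      omega

/-- The triangulation `ψ(u)` of the `(n+2)`-gon: it corresponds to the binary tree of the
one-line notation `u(1) u(2) ⋯ u(n)`. -/
def psi {n : ℕ} (u : Equiv.Perm (Fin n)) : Triangulation n :=
  Triangulation.ofTree (minTree (List.ofFn fun i => (u i : ℕ)))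
    (by rw [numNodes_minTree, List.length_ofFn])

/-- The longest element `w_0` of the symmetric group on `n` letters, `w_0(i) = n + 1 - i`. -/
def longest (n : ℕ) : Equiv.Perm (Fin n) := Fin.revPerm

end CatalanFan

/-! Let `U = paddedSeq u`: the entries of `u`, lowered by 1, at positions 1, ..., n, with the larger
value n at positions 0 and n+1. With positions counted from 0, t(u) reads `U` from position 1 on and
t(u)s(n,1) reads it from position 0 on. By the rank criterion, z lies in the interval iff, for all k
and p, the number of entries ≥ p among its first k lies between the numbers for `U` on [1, k+1) and
on [0, k) (`mem_interval_iff`).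

For 1 ≤ k ≤ n let a < k < b be the nearest positions with a larger value of `U`. Subtracting rank
bounds shows that z sums over [a, k) to at least the sum of `U` over (a, k], and over [k, b) to at
least the sum of `U` over [k, b). Both cannot be equalities: that would give z on [a, b) the sum of
`U` over (a, b) plus `U k`, while it has at least that sum plus min(`U a`, `U b`)
(`SeqBounds.lt_sum`). Conversely, one inequality per k can be prescribed at will and made tight by a
single z (`exists_isFilling`): on an interval, z carries the inner entries of `U` and one larger
extra entry; at the largest inner entry `U k` one side receives `U k` as its extra entry and the
other side keeps the old one.

So the polytope is a combinatorial cube whose facets pair up by k, with inner normals ϖ_k - ϖ_a and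
ϖ_b - ϖ_k. Each class in N ⊗ ℝ is a nonnegative combination of normals from different pairs
(`exists_nonneg_combination`), and the normal fan follows formally (`IsCubical.normalFan_eq`).

Conjugation by w_0 reverses positions and values, so the tree of minima of w_0uw_0 is the mirrored
tree of maxima of u: the neighbours a and b of k become the right and left neighbours of n+1-k
(`psi_nbr`). The lattice automorphism x ↦ -(reverse of x) sends ϖ_i to ϖ_{n+1-i}, hence the normals
to the vectors v and w. -/

namespace CatalanFan

/-! ### Counting functions -/

/-- The number of `j` in `[a, b)` with `p ≤ f j`. -/
def cnt (f : ℕ → ℕ) (a b p : ℕ) : ℕ := ((Finset.Ico a b).filter fun j => p ≤ f j).card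

theorem cnt_add (f : ℕ → ℕ) {a b c : ℕ} (h : a ≤ b) (h' : b ≤ c) (p : ℕ) :
    cnt f a c p = cnt f a b p + cnt f b c p := by
  rw [cnt, cnt, cnt, ← Finset.Ico_union_Ico_eq_Ico h h', Finset.filter_union,
    Finset.card_union_of_disjoint]
  exact Finset.disjoint_filter_filter (Finset.Ico_disjoint_Ico_consecutive a b c)

theorem cnt_self (f : ℕ → ℕ) (a p : ℕ) : cnt f a a p = 0 := by simp [cnt]

theorem cnt_single (f : ℕ → ℕ) (a p : ℕ) : cnt f a (a + 1) p = if p ≤ f a then 1 else 0 := by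
  rw [cnt, Nat.Ico_succ_singleton, Finset.filter_singleton]
  split_ifs <;> simp

theorem cnt_succ (f : ℕ → ℕ) {a b : ℕ} (h : a ≤ b) (p : ℕ) :
    cnt f a (b + 1) p = cnt f a b p + if p ≤ f b then 1 else 0 := by
  rw [cnt_add f h (Nat.le_succ b), cnt_single]

theorem cnt_congr {f g : ℕ → ℕ} {a b : ℕ} (h : ∀ j, a ≤ j → j < b → f j = g j) (p : ℕ) :
    cnt f a b p = cnt g a b p := by
  rw [cnt, cnt]
  congr 1
  refine Finset.filter_congr fun j hj => ?_
  rw [Finset.mem_Ico] at hj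
  rw [h j hj.1 hj.2]

theorem cnt_eq_zero {f : ℕ → ℕ} {a b p : ℕ} (h : ∀ j, a ≤ j → j < b → f j < p) :
    cnt f a b p = 0 := by
  rw [cnt, Finset.card_eq_zero, Finset.filter_eq_empty_iff]
  intro j hj
  rw [Finset.mem_Ico] at hj
  exact not_le.2 (h j hj.1 hj.2)

theorem cnt_shift (f : ℕ → ℕ) (a b p : ℕ) :
    cnt (fun j => f (j + 1)) a b p = cnt f (a + 1) (b + 1) p := by
  rw [cnt, cnt, ← Finset.map_add_right_Ico, Finset.filter_map, Finset.card_map]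
  rfl

theorem sum_eq_sum_cnt {f : ℕ → ℕ} {a b N : ℕ} (h : ∀ j, a ≤ j → j < b → f j ≤ N) :
    ∑ j ∈ Finset.Ico a b, f j = ∑ p ∈ Finset.range N, cnt f a b (p + 1) := by
  simp only [cnt, Finset.card_filter]
  rw [Finset.sum_comm]
  refine Finset.sum_congr rfl fun j hj => ?_
  rw [Finset.mem_Ico] at hj
  rw [← Finset.card_filter]
  have : (Finset.range N).filter (fun p => p + 1 ≤ f j) = Finset.range (f j) := by
    ext p
    have := h j hj.1 hj.2
    simp only [Finset.mem_filter, Finset.mem_range]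
    omega
  rw [this, Finset.card_range]

/-- The bridge from rank conditions to linear inequalities: a sum of natural numbers is the sum over
p ≥ 1 of the number of terms ≥ p. -/
theorem sum_le_of_cnt_le {f g : ℕ → ℕ} {a b c d : ℕ} (h : ∀ p, cnt f a b p ≤ cnt g c d p) :
    ∑ j ∈ Finset.Ico a b, f j ≤ ∑ j ∈ Finset.Ico c d, g j := by
  set N := ∑ j ∈ Finset.Ico a b, f j + ∑ j ∈ Finset.Ico c d, g j with hN
  have hf : ∀ j, a ≤ j → j < b → f j ≤ N := fun j h1 h2 =>
    (Finset.single_le_sum (f := f) (fun _ _ => Nat.zero_le _) (Finset.mem_Ico.2 ⟨h1, h2⟩)).trans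
      (Nat.le_add_right _ _)
  have hg : ∀ j, c ≤ j → j < d → g j ≤ N := fun j h1 h2 =>
    (Finset.single_le_sum (f := g) (fun _ _ => Nat.zero_le _) (Finset.mem_Ico.2 ⟨h1, h2⟩)).trans
      (Nat.le_add_left _ _)
  rw [sum_eq_sum_cnt hf, sum_eq_sum_cnt hg]
  exact Finset.sum_le_sum fun p _ => h (p + 1)

/-! ### Inversions and reduced words -/

/-- The set of inversions of a permutation. -/
def inversions {m : ℕ} (w : Equiv.Perm (Fin m)) : Finset (Fin m × Fin m) :=
  Finset.univ.filter fun x => x.1 < x.2 ∧ w x.2 < w x.1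

theorem mem_inversions {m : ℕ} {w : Equiv.Perm (Fin m)} {x : Fin m × Fin m} :
    x ∈ inversions w ↔ x.1 < x.2 ∧ w x.2 < w x.1 := by
  simp [inversions]

theorem simpleTransposition_mul_self {n : ℕ} (i : Fin n) :
    simpleTransposition i * simpleTransposition i = 1 := Equiv.swap_mul_self _ _

theorem simpleTransposition_apply_apply {n : ℕ} (i : Fin n) (a : Fin (n + 1)) :
    simpleTransposition i (simpleTransposition i a) = a := by
  rw [← Equiv.Perm.mul_apply, simpleTransposition_mul_self, Equiv.Perm.one_apply]

theorem simpleTransposition_lt {n : ℕ} (i : Fin n) {a b : Fin (n + 1)} (h : a < b)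
    (h' : ¬ (a = i.castSucc ∧ b = i.succ)) :
    simpleTransposition i a < simpleTransposition i b := by
  simp only [Fin.lt_def, Fin.ext_iff, Fin.val_castSucc, Fin.val_succ] at h h'
  simp only [simpleTransposition, Equiv.swap_apply_def, Fin.ext_iff, Fin.val_castSucc,
    Fin.val_succ]
  split_ifs <;> simp only [Fin.lt_def, Fin.val_castSucc, Fin.val_succ] <;> omega

theorem card_inversions_mul_of_lt {n : ℕ} (w : Equiv.Perm (Fin (n + 1))) (i : Fin n)
    (h : w i.castSucc < w i.succ) :
    (inversions (w * simpleTransposition i)).card = (inversions w).card + 1 := by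
  set s := simpleTransposition i with hs
  have hs1 : s i.castSucc = i.succ := Equiv.swap_apply_left _ _
  have hs2 : s i.succ = i.castSucc := Equiv.swap_apply_right _ _
  have hss : ∀ a, s (s a) = a := simpleTransposition_apply_apply i
  -- Applying s to both positions preserves the order of every pair except (i, i+1), so that pair is
  -- the only new inversion.
  have key : inversions (w * s) =
      insert (i.castSucc, i.succ) ((inversions w).map (s.prodCongr s).toEmbedding) := by
    ext ⟨a, b⟩
    simp only [mem_inversions, Finset.mem_insert, Finset.mem_map_equiv, Equiv.Perm.mul_apply,
      Prod.mk.injEq, Equiv.prodCongr_symm,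
      Equiv.prodCongr_apply, Prod.map]
    have hsymm : s.symm = s := Equiv.symm_swap _ _
    rw [hsymm]
    constructor
    · rintro ⟨h1, h2⟩
      by_cases h3 : a = i.castSucc ∧ b = i.succ
      · exact Or.inl h3
      · exact Or.inr ⟨simpleTransposition_lt i h1 h3, h2⟩
    · rintro (⟨rfl, rfl⟩ | ⟨h1, h2⟩)
      · rw [hs1, hs2]
        exact ⟨Fin.castSucc_lt_succ, h⟩
      · refine ⟨?_, h2⟩
        have := simpleTransposition_lt i h1 (fun h3 => by
          rw [h3.1, h3.2] at h2
          exact absurd h2 (not_lt.2 h.le))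
        rwa [← hs, hss, hss] at this
  rw [key, Finset.card_insert_of_notMem, Finset.card_map]
  simp only [mem_inversions, Finset.mem_map_equiv, Equiv.prodCongr_symm,
    Equiv.prodCongr_apply, Prod.map, not_and]
  have hsymm : s.symm = s := Equiv.symm_swap _ _
  rw [hsymm, hs1, hs2]
  intro h1
  exact absurd h1 (not_lt.2 Fin.castSucc_lt_succ.le)

theorem card_inversions_mul_of_gt {n : ℕ} (w : Equiv.Perm (Fin (n + 1))) (i : Fin n)
    (h : w i.succ < w i.castSucc) :
    (inversions w).card = (inversions (w * simpleTransposition i)).card + 1 := by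
  have := card_inversions_mul_of_lt (w * simpleTransposition i) i (by
    simpa [Equiv.Perm.mul_apply, simpleTransposition] using h)
  rwa [mul_assoc, simpleTransposition_mul_self, mul_one] at this

theorem wordProd_append_singleton {n : ℕ} (ω : List (Fin n)) (i : Fin n) :
    wordProd (ω ++ [i]) = wordProd ω * simpleTransposition i := by
  simp [wordProd]

theorem ascent_or_descent {n : ℕ} (w : Equiv.Perm (Fin (n + 1))) (i : Fin n) :
    w i.castSucc < w i.succ ∨ w i.succ < w i.castSucc :=
  lt_or_gt_of_ne fun h => absurd (w.injective h) Fin.castSucc_lt_succ.ne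

theorem card_inversions_wordProd_le {n : ℕ} (ω : List (Fin n)) :
    (inversions (wordProd ω)).card ≤ ω.length := by
  induction ω using List.reverseRecOn with
  | nil =>
    rw [List.length_nil, Nat.le_zero, Finset.card_eq_zero, inversions,
      Finset.filter_eq_empty_iff]
    rintro x - ⟨h1, h2⟩
    exact absurd h1 (not_lt.2 (by simpa [wordProd] using h2.le))
  | append_singleton ω i ih =>
    rw [wordProd_append_singleton, List.length_append, List.length_singleton]
    rcases ascent_or_descent (wordProd ω) i with h | h
    · have := card_inversions_mul_of_lt _ i h; omega
    · have := card_inversions_mul_of_gt _ i h; omega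

theorem eq_one_of_no_descent {n : ℕ} (w : Equiv.Perm (Fin (n + 1)))
    (h : ∀ i : Fin n, w i.castSucc < w i.succ) : w = 1 := by
  have hm : StrictMono w := Fin.strictMono_iff_lt_succ.2 h
  have : Subsingleton (Fin (n + 1) ≃o Fin (n + 1)) := inferInstance
  have e := Subsingleton.elim
    (hm.orderIsoOfSurjective w w.surjective) (OrderIso.refl _)
  ext x
  have := congrArg (fun f : Fin (n + 1) ≃o Fin (n + 1) => f x) e
  simpa using congrArg Fin.val this

theorem exists_word {n : ℕ} (w : Equiv.Perm (Fin (n + 1))) :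
    ∃ ω : List (Fin n), wordProd ω = w ∧ ω.length = (inversions w).card := by
  induction h : (inversions w).card generalizing w with
  | zero =>
    refine ⟨[], ?_, rfl⟩
    rw [eq_one_of_no_descent w fun i => (ascent_or_descent w i).resolve_right fun hi => ?_]
    · rfl
    · have := card_inversions_mul_of_gt w i hi; omega
  | succ m ih =>
    by_cases hd : ∃ i : Fin n, w i.succ < w i.castSucc
    · obtain ⟨i, hi⟩ := hd
      have := card_inversions_mul_of_gt w i hi
      obtain ⟨ω, h1, h2⟩ := ih (w * simpleTransposition i) (by omega)
      refine ⟨ω ++ [i], ?_, by simp [h2]⟩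
      rw [wordProd_append_singleton, h1, mul_assoc, simpleTransposition_mul_self, mul_one]
    · push Not at hd
      have hw := eq_one_of_no_descent w fun i =>
        (ascent_or_descent w i).resolve_right (not_lt.2 (hd i))
      have h1 := card_inversions_wordProd_le ([] : List (Fin n))
      have h2 : wordProd ([] : List (Fin n)) = 1 := rfl
      rw [h2, ← hw, h] at h1
      simp at h1

/-- Each letter changes the number of inversions by exactly one, and removing descents reaches the
identity; hence the minimal length is the inversion number. -/
theorem isReducedWord_iff {n : ℕ} (ω : List (Fin n)) (w : Equiv.Perm (Fin (n + 1))) :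
    IsReducedWord ω w ↔ wordProd ω = w ∧ ω.length = (inversions w).card := by
  refine and_congr_right fun h => ?_
  constructor
  · intro h1
    obtain ⟨ω', h2, h3⟩ := exists_word w
    have h4 := card_inversions_wordProd_le ω
    have h5 := h1 ω' h2
    rw [h] at h4
    omega
  · rintro h1 ω' rfl
    exact h1.le.trans (card_inversions_wordProd_le ω')

/-! ### The rank criterion for the Bruhat order -/

/-- The one-line notation as a function on `ℕ`. -/
def oneLine {n : ℕ} (w : Equiv.Perm (Fin (n + 1))) (j : ℕ) : ℕ :=
  if h : j < n + 1 then w ⟨j, h⟩ else 0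

theorem oneLine_of_lt {n : ℕ} (w : Equiv.Perm (Fin (n + 1))) {j : ℕ} (h : j < n + 1) :
    oneLine w j = w ⟨j, h⟩ := dif_pos h

theorem oneLine_le {n : ℕ} (w : Equiv.Perm (Fin (n + 1))) (j : ℕ) : oneLine w j ≤ n := by
  rw [oneLine]
  split_ifs
  · exact Nat.lt_succ_iff.1 (w _).2
  · exact Nat.zero_le _

theorem oneLine_mul {n : ℕ} (w : Equiv.Perm (Fin (n + 1))) (i : Fin n) (j : ℕ) :
    oneLine (w * simpleTransposition i) j =
      if j = i then oneLine w (i + 1) else if j = i + 1 then oneLine w i else oneLine w j := by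
  have hi := i.2
  by_cases h : j < n + 1
  · rw [oneLine_of_lt _ h, Equiv.Perm.mul_apply, simpleTransposition, Equiv.swap_apply_def]
    simp only [Fin.ext_iff, Fin.val_castSucc, Fin.val_succ]
    split_ifs with h1 h2
    · rw [oneLine_of_lt _ (by omega)]; rfl
    · rw [oneLine_of_lt _ (by omega)]; rfl
    · rw [oneLine_of_lt _ h]
  · rw [if_neg (by omega), if_neg (by omega), oneLine, oneLine, dif_neg h, dif_neg h]

theorem cnt_oneLine_mul_of_ne {n : ℕ} (w : Equiv.Perm (Fin (n + 1))) (i : Fin n) {k : ℕ}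
    (hk : k ≠ i + 1) (p : ℕ) :
    cnt (oneLine (w * simpleTransposition i)) 0 k p = cnt (oneLine w) 0 k p := by
  rcases lt_or_gt_of_ne hk with h | h
  · refine cnt_congr (fun j _ hj => ?_) p
    rw [oneLine_mul, if_neg (by omega), if_neg (by omega)]
  · rw [cnt_add _ (Nat.zero_le (i + 2 : ℕ)) h, cnt_add (oneLine w) (Nat.zero_le (i + 2 : ℕ)) h]
    congr 1
    · have h1 : oneLine (w * simpleTransposition i) (i + 1) = oneLine w i := by
        simp [oneLine_mul]
      have h2 : oneLine (w * simpleTransposition i) i = oneLine w (i + 1) := by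
        simp [oneLine_mul]
      rw [cnt_succ _ (Nat.zero_le _), cnt_succ _ (Nat.zero_le _), cnt_succ _ (Nat.zero_le _),
        cnt_succ _ (Nat.zero_le _), h1, h2]
      have : cnt (oneLine (w * simpleTransposition i)) 0 i p = cnt (oneLine w) 0 i p := by
        refine cnt_congr (fun j _ hj => ?_) p
        rw [oneLine_mul, if_neg (by omega), if_neg (by omega)]
      omega
    · refine cnt_congr (fun j hj _ => ?_) p
      rw [oneLine_mul, if_neg (by omega), if_neg (by omega)]

theorem cnt_oneLine_mul {n : ℕ} (w : Equiv.Perm (Fin (n + 1))) (i : Fin n) (p : ℕ) :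
    cnt (oneLine (w * simpleTransposition i)) 0 (i + 1) p =
      cnt (oneLine w) 0 i p + if p ≤ oneLine w (i + 1) then 1 else 0 := by
  rw [cnt_succ _ (Nat.zero_le _), cnt_oneLine_mul_of_ne _ _ (by omega), oneLine_mul, if_pos rfl]

/-- The comparison of rank functions. -/
def RankLE {n : ℕ} (v w : Equiv.Perm (Fin (n + 1))) : Prop :=
  ∀ k p, cnt (oneLine v) 0 k p ≤ cnt (oneLine w) 0 k p

theorem oneLine_castSucc {n : ℕ} (w : Equiv.Perm (Fin (n + 1))) (i : Fin n) :
    oneLine w i = w i.castSucc := by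
  have := i.2
  rw [oneLine_of_lt _ (by omega)]; rfl

theorem oneLine_succ {n : ℕ} (w : Equiv.Perm (Fin (n + 1))) (i : Fin n) :
    oneLine w (i + 1) = w i.succ := by
  have := i.2
  rw [oneLine_of_lt _ (by omega)]; rfl

/-- Only the prefix of length i+1 is altered. For p ≤ w(i+1) the new entry counts on the right, and
the prefixes of length i suffice. For larger p neither of the entries of w at i and i+1 counts, and
the prefixes of length i+2 give the bound. The three companions below rest on the same comparison of
neighbouring prefixes. -/
theorem RankLE.mul_mul {n : ℕ} {v w : Equiv.Perm (Fin (n + 1))} (h : RankLE v w) (i : Fin n)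
    (hw : w i.castSucc < w i.succ) :
    RankLE (v * simpleTransposition i) (w * simpleTransposition i) := by
  intro k p
  by_cases hk : k = i + 1
  · subst hk
    rw [Fin.lt_def, ← oneLine_castSucc, ← oneLine_succ] at hw
    have h0 := h i p
    have h1 := h (i + 1 + 1) p
    rw [cnt_oneLine_mul, cnt_oneLine_mul]
    simp only [cnt_succ _ (Nat.zero_le _)] at h1
    split_ifs at h1 ⊢ <;> omega
  · rw [cnt_oneLine_mul_of_ne _ _ hk, cnt_oneLine_mul_of_ne _ _ hk]
    exact h k p

theorem RankLE.le_mul {n : ℕ} {v w : Equiv.Perm (Fin (n + 1))} (h : RankLE v w) (i : Fin n)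
    (hw : w i.castSucc < w i.succ) : RankLE v (w * simpleTransposition i) := by
  intro k p
  by_cases hk : k = i + 1
  · subst hk
    rw [Fin.lt_def, ← oneLine_castSucc, ← oneLine_succ] at hw
    have h1 := h (i + 1) p
    rw [cnt_oneLine_mul]
    simp only [cnt_succ _ (Nat.zero_le _)] at h1 ⊢
    split_ifs at h1 ⊢ <;> omega
  · rw [cnt_oneLine_mul_of_ne _ _ hk]
    exact h k p

theorem RankLE.mul_mul_of_descent {n : ℕ} {v w : Equiv.Perm (Fin (n + 1))} (h : RankLE v w)
    (i : Fin n) (hv : v i.succ < v i.castSucc) :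
    RankLE (v * simpleTransposition i) (w * simpleTransposition i) := by
  intro k p
  by_cases hk : k = i + 1
  · subst hk
    rw [Fin.lt_def, ← oneLine_castSucc, ← oneLine_succ] at hv
    have h0 := h i p
    have h1 := h (i + 1 + 1) p
    rw [cnt_oneLine_mul, cnt_oneLine_mul]
    simp only [cnt_succ _ (Nat.zero_le _)] at h1
    split_ifs at h1 ⊢ <;> omega
  · rw [cnt_oneLine_mul_of_ne _ _ hk, cnt_oneLine_mul_of_ne _ _ hk]
    exact h k p

theorem RankLE.le_mul_of_ascent {n : ℕ} {v w : Equiv.Perm (Fin (n + 1))} (h : RankLE v w)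
    (i : Fin n) (hv : v i.castSucc < v i.succ) : RankLE v (w * simpleTransposition i) := by
  intro k p
  by_cases hk : k = i + 1
  · subst hk
    rw [Fin.lt_def, ← oneLine_castSucc, ← oneLine_succ] at hv
    have h0 := h i p
    have h1 := h (i + 1 + 1) p
    rw [cnt_oneLine_mul, cnt_succ _ (Nat.zero_le _)]
    simp only [cnt_succ _ (Nat.zero_le _)] at h1
    split_ifs at h1 ⊢ <;> omega
  · rw [cnt_oneLine_mul_of_ne _ _ hk]
    exact h k p

theorem RankLE.eq_one {n : ℕ} {v : Equiv.Perm (Fin (n + 1))} (h : RankLE v 1) : v = 1 := by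
  refine eq_one_of_no_descent v fun i => (ascent_or_descent v i).resolve_right fun hi => ?_
  have hle : ∀ x : Fin (n + 1), (v x : ℕ) ≤ x := by
    intro x
    by_contra hx
    -- The first x+1 entries of the identity are all at most x, so v has no entry above x there
    -- either. Equal total sums then force v x = x.
    have h1 := h (x + 1) (x + 1)
    have h2 : cnt (oneLine (1 : Equiv.Perm (Fin (n + 1)))) 0 (x + 1) (x + 1) = 0 := by
      refine cnt_eq_zero fun j _ hj => ?_
      have := x.2
      rw [oneLine_of_lt _ (by omega)]
      exact hj
    rw [h2, cnt_succ _ (Nat.zero_le _), oneLine_of_lt _ x.2, if_pos (by simpa using hx)] at h1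
    omega
  have hsum : ∑ x, (v x : ℕ) = ∑ x : Fin (n + 1), (x : ℕ) :=
    Equiv.sum_comp v (fun x => (x : ℕ))
  have heq := (Finset.sum_eq_sum_iff_of_le (fun x _ => hle x)).1 hsum
  have h1 := heq i.castSucc (Finset.mem_univ _)
  have h2 := heq i.succ (Finset.mem_univ _)
  rw [Fin.lt_def, h1, h2] at hi
  simp at hi

/-- A reduced word stays reduced without its last letter, which therefore acts at an ascent; the
subword either uses or omits that letter. -/
theorem rankLE_of_sublist {n : ℕ} (ω : List (Fin n))
    (hω : ω.length = (inversions (wordProd ω)).card) (ω' : List (Fin n)) (h : ω'.Sublist ω) :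
    RankLE (wordProd ω') (wordProd ω) := by
  induction ω using List.reverseRecOn generalizing ω' with
  | nil => rw [List.sublist_nil.1 h]; exact fun _ _ => le_rfl
  | append_singleton ω i ih =>
    rw [wordProd_append_singleton, List.length_append, List.length_singleton] at hω
    have hle := card_inversions_wordProd_le ω
    have hasc : wordProd ω i.castSucc < wordProd ω i.succ :=
      (ascent_or_descent _ i).resolve_right fun hi => by
        have := card_inversions_mul_of_gt _ i hi
        omega
    have hcard := card_inversions_mul_of_lt _ i hasc
    rw [wordProd_append_singleton]
    obtain ⟨l₁, l₂, rfl, h1, h2⟩ := List.sublist_append_iff.1 h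
    have hl := ih (by omega) l₁ h1
    rcases List.sublist_singleton.1 h2 with rfl | rfl
    · rw [List.append_nil]
      exact hl.le_mul i hasc
    · rw [wordProd_append_singleton]
      exact hl.mul_mul i hasc

/-- The lifting property: at a descent of w, strip the letter from w, and also from v if v descends
there. The rank comparison survives and w loses an inversion. -/
theorem bruhatLE_of_rankLE {n : ℕ} {v w : Equiv.Perm (Fin (n + 1))} (h : RankLE v w) :
    BruhatLE v w := by
  induction hm : (inversions w).card using Nat.strong_induction_on generalizing v w with
  | _ m ih =>
    by_cases hd : ∃ i : Fin n, w i.succ < w i.castSucc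
    · obtain ⟨i, hi⟩ := hd
      have hc := card_inversions_mul_of_gt w i hi
      rcases ascent_or_descent v i with hv | hv
      · obtain ⟨ω', ω, h1, h2, h3⟩ := ih _ (by omega) (h.le_mul_of_ascent i hv) rfl
        refine ⟨ω', ω ++ [i], h1, ?_, h3.trans (List.sublist_append_left _ _)⟩
        rw [isReducedWord_iff] at h2 ⊢
        refine ⟨?_, by simp [h2.2, hc]⟩
        rw [wordProd_append_singleton, h2.1, mul_assoc, simpleTransposition_mul_self, mul_one]
      · have hc' := card_inversions_mul_of_gt v i hv
        obtain ⟨ω', ω, h1, h2, h3⟩ := ih _ (by omega) (h.mul_mul_of_descent i hv) rfl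
        refine ⟨ω' ++ [i], ω ++ [i], ?_, ?_, h3.append (List.Sublist.refl _)⟩
        · rw [isReducedWord_iff] at h1 ⊢
          refine ⟨?_, by simp [h1.2, hc']⟩
          rw [wordProd_append_singleton, h1.1, mul_assoc, simpleTransposition_mul_self, mul_one]
        · rw [isReducedWord_iff] at h2 ⊢
          refine ⟨?_, by simp [h2.2, hc]⟩
          rw [wordProd_append_singleton, h2.1, mul_assoc, simpleTransposition_mul_self, mul_one]
    · push Not at hd
      obtain rfl := eq_one_of_no_descent w fun i =>
        (ascent_or_descent w i).resolve_right (not_lt.2 (hd i))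
      obtain rfl := h.eq_one
      obtain ⟨ω, hω⟩ := exists_word (1 : Equiv.Perm (Fin (n + 1)))
      exact ⟨ω, ω, (isReducedWord_iff _ _).2 hω, (isReducedWord_iff _ _).2 hω,
        List.Sublist.refl _⟩

/-- The rank criterion for the Bruhat order. -/
theorem bruhatLE_iff_rankLE {n : ℕ} {v w : Equiv.Perm (Fin (n + 1))} :
    BruhatLE v w ↔ RankLE v w := by
  refine ⟨?_, bruhatLE_of_rankLE⟩
  rintro ⟨ω', ω, h1, h2, h3⟩
  rw [isReducedWord_iff] at h2
  obtain ⟨rfl, h4⟩ := h2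
  rw [← h1.1]
  exact rankLE_of_sublist ω h4 ω' h3

/-! ### The interval between `t(u)` and `t(u) s(n,1)` -/

theorem wordProd_take_reverse {n : ℕ} (m : ℕ) (hm : m ≤ n) (j : Fin (n + 1)) :
    (wordProd ((List.finRange n).take m).reverse j : ℕ) =
      if (j : ℕ) = 0 then m else if (j : ℕ) ≤ m then (j : ℕ) - 1 else j := by
  induction m generalizing j with
  | zero =>
    simp only [List.take_zero, List.reverse_nil, wordProd, List.map_nil, List.prod_nil,
      Equiv.Perm.one_apply]
    split_ifs <;> omega
  | succ m ih =>
    have h1 : (List.finRange n).take (m + 1) = (List.finRange n).take m ++ [⟨m, hm⟩] := by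
      rw [List.take_succ_eq_append_getElem (by simpa using hm)]
      simp
    have h2 := ih (by omega) j
    rw [h1, List.reverse_append, List.reverse_singleton, List.singleton_append, wordProd,
      List.map_cons, List.prod_cons, Equiv.Perm.mul_apply, ← wordProd, simpleTransposition,
      Equiv.swap_apply_def]
    simp only [Fin.ext_iff, Fin.val_castSucc, Fin.val_succ]
    generalize (wordProd ((List.finRange n).take m).reverse j : Fin (n + 1)) = x at h2 ⊢
    split_ifs at h2 ⊢ <;> (try simp only [Fin.val_succ, Fin.val_castSucc]) <;> omega

theorem sDown_apply {n : ℕ} (j : Fin (n + 1)) :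
    (sDown n j : ℕ) = if (j : ℕ) = 0 then n else (j : ℕ) - 1 := by
  have h := wordProd_take_reverse n le_rfl j
  have hj := j.2
  have h1 : (List.finRange n).take n = List.finRange n :=
    List.take_of_length_le (by simp)
  rw [h1] at h
  rw [sDown, h]
  split_ifs <;> omega

/-- The one-line notation of `u` at the positions `1, …, n`, with the value `n` (greater than
all entries) at all other positions. -/
def paddedSeq {n : ℕ} (u : Equiv.Perm (Fin n)) (j : ℕ) : ℕ :=
  if h : 1 ≤ j ∧ j ≤ n then u ⟨j - 1, by omega⟩ else n

theorem paddedSeq_le {n : ℕ} (u : Equiv.Perm (Fin n)) (j : ℕ) : paddedSeq u j ≤ n := by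
  rw [paddedSeq]
  split_ifs
  · exact (u _).2.le
  · exact le_rfl

theorem paddedSeq_lt {n : ℕ} (u : Equiv.Perm (Fin n)) {j : ℕ} (h : 1 ≤ j) (h' : j ≤ n) :
    paddedSeq u j < n := by
  rw [paddedSeq, dif_pos ⟨h, h'⟩]
  exact (u _).2

theorem paddedSeq_of_not {n : ℕ} (u : Equiv.Perm (Fin n)) {j : ℕ} (h : ¬ (1 ≤ j ∧ j ≤ n)) :
    paddedSeq u j = n := dif_neg h

theorem paddedSeq_inj {n : ℕ} (u : Equiv.Perm (Fin n)) {i j : ℕ} (hi : 1 ≤ i) (hi' : i ≤ n)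
    (hj : 1 ≤ j) (hj' : j ≤ n) (h : paddedSeq u i = paddedSeq u j) : i = j := by
  rw [paddedSeq, dif_pos ⟨hi, hi'⟩, paddedSeq, dif_pos ⟨hj, hj'⟩, Fin.val_inj,
    u.injective.eq_iff, Fin.mk.injEq] at h
  omega

theorem oneLine_addTail {n : ℕ} (u : Equiv.Perm (Fin n)) {j : ℕ} (hj : j < n + 1) :
    oneLine (addTail u) j = paddedSeq u (j + 1) := by
  rw [oneLine_of_lt _ hj]
  rcases (Nat.lt_succ_iff.1 hj).lt_or_eq with h | rfl
  · rw [paddedSeq, dif_pos (by omega)]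
    exact congrArg Fin.val (addTail_castSucc u ⟨j, h⟩)
  · rw [paddedSeq_of_not _ (by omega)]
    exact congrArg Fin.val (addTail_last u)

theorem oneLine_addTail_mul_sDown {n : ℕ} (u : Equiv.Perm (Fin n)) {j : ℕ} (hj : j < n + 1) :
    oneLine (addTail u * sDown n) j = paddedSeq u j := by
  rw [oneLine_of_lt _ hj, Equiv.Perm.mul_apply]
  have h := sDown_apply (⟨j, hj⟩ : Fin (n + 1))
  simp only at h
  have h2 := oneLine_of_lt (addTail u) (sDown n ⟨j, hj⟩).2
  rw [Fin.eta] at h2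
  rw [← h2, oneLine_addTail _ (sDown n ⟨j, hj⟩).2, h]
  split_ifs with h0
  · rw [paddedSeq_of_not _ (by omega), paddedSeq_of_not _ (by omega)]
  · congr 1; omega

/-- The counting bounds that describe the one-line notations in the interval. -/
def SeqBounds (n : ℕ) (U z : ℕ → ℕ) : Prop :=
  ∀ k ≤ n + 1, ∀ p, cnt U 1 (k + 1) p ≤ cnt z 0 k p ∧ cnt z 0 k p ≤ cnt U 0 k p

theorem rankLE_iff {n : ℕ} {v w : Equiv.Perm (Fin (n + 1))} :
    RankLE v w ↔ ∀ k ≤ n + 1, ∀ p, cnt (oneLine v) 0 k p ≤ cnt (oneLine w) 0 k p := by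
  refine ⟨fun h k _ => h k, fun h k p => ?_⟩
  rcases le_total k (n + 1) with hk | hk
  · exact h k hk p
  · rw [cnt_add _ (Nat.zero_le _) hk, cnt_add (oneLine w) (Nat.zero_le _) hk]
    refine add_le_add (h _ le_rfl p) (cnt_congr (fun j hj _ => ?_) p).le
    rw [oneLine, oneLine, dif_neg (by omega), dif_neg (by omega)]

theorem mem_interval_iff {n : ℕ} (u : Equiv.Perm (Fin n)) (z : Equiv.Perm (Fin (n + 1))) :
    BruhatLE (addTail u) z ∧ BruhatLE z (addTail u * sDown n) ↔
      SeqBounds n (paddedSeq u) (oneLine z) := by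
  have h1 : ∀ k ≤ n + 1, ∀ p, cnt (oneLine (addTail u)) 0 k p = cnt (paddedSeq u) 1 (k + 1) p :=
    fun k hk p => by
      rw [← cnt_shift]
      exact cnt_congr (fun j _ hj => oneLine_addTail u (by omega)) p
  have h2 : ∀ k ≤ n + 1, ∀ p,
      cnt (oneLine (addTail u * sDown n)) 0 k p = cnt (paddedSeq u) 0 k p :=
    fun k hk p => cnt_congr (fun j _ hj => oneLine_addTail_mul_sDown u (by omega)) p
  rw [bruhatLE_iff_rankLE, bruhatLE_iff_rankLE, rankLE_iff, rankLE_iff]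
  constructor
  · rintro ⟨h3, h4⟩ k hk p
    exact ⟨(h1 k hk p).symm.le.trans (h3 k hk p), (h4 k hk p).trans (h2 k hk p).le⟩
  · intro h
    exact ⟨fun k hk p => (h1 k hk p).le.trans (h k hk p).1,
      fun k hk p => (h k hk p).2.trans (h2 k hk p).symm.le⟩

/-- The lower bound at k minus the upper bound at a. For p ≤ `U a` the surplus leading entry `U 0`
of the upper bound is cancelled by `U a`; for p > `U a` no entry of `U` on (a, k] counts. -/
theorem SeqBounds.left {n : ℕ} {U z : ℕ → ℕ} (h : SeqBounds n U z) (h0 : ∀ j, U j ≤ U 0)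
    {a k : ℕ} (hak : a < k) (hk : k ≤ n + 1) (hlt : ∀ i, a < i → i < k → U i < U k)
    (hka : U k ≤ U a) (p : ℕ) : cnt U (a + 1) (k + 1) p ≤ cnt z a k p := by
  by_cases hp : p ≤ U a
  · have h1 := (h k hk p).1
    have h2 := (h a (by omega) p).2
    have h3 := cnt_add z (Nat.zero_le a) hak.le p
    have h4 := cnt_add U (show 1 ≤ a + 1 by omega) (show a + 1 ≤ k + 1 by omega) p
    have h5 := cnt_succ U (Nat.zero_le a) p
    have h6 := cnt_add U (Nat.zero_le 1) (show 1 ≤ a + 1 by omega) p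
    have h7 := cnt_single U 0 p
    rw [if_pos hp] at h5
    rw [zero_add, if_pos (hp.trans (h0 a))] at h7
    omega
  · rw [cnt_eq_zero]
    · exact Nat.zero_le _
    · intro j hj hj'
      rcases (Nat.lt_succ_iff.1 hj').lt_or_eq with h1 | rfl
      · have := hlt j hj h1; omega
      · omega

theorem SeqBounds.right {n : ℕ} {U z : ℕ → ℕ} (h : SeqBounds n U z) (h0 : ∀ j, U j ≤ U 0)
    {k b : ℕ} (hkb : k < b) (hb : b ≤ n + 1) (hlt : ∀ i, k < i → i < b → U i < U k)
    (hkb' : U k ≤ U b) (p : ℕ) : cnt U k b p ≤ cnt z k b p := by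
  by_cases hp : p ≤ U b
  · have h1 := (h b hb p).1
    have h2 := (h k (by omega) p).2
    have h3 := cnt_add z (Nat.zero_le k) hkb.le p
    have h4 := cnt_add U (Nat.zero_le k) hkb.le p
    have h5 := cnt_succ U (Nat.zero_le b) p
    have h6 := cnt_add U (Nat.zero_le 1) (show 1 ≤ b + 1 by omega) p
    have h7 := cnt_single U 0 p
    rw [if_pos hp] at h5
    rw [zero_add, if_pos (hp.trans (h0 b))] at h7
    omega
  · rw [cnt_eq_zero]
    · exact Nat.zero_le _
    · intro j hj hj'
      rcases hj.lt_or_eq with h1 | rfl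
      · have := hlt j h1 hj'; omega
      · omega

/-- `a` and `b` are the nearest positions on the left and on the right of `k` where `U` exceeds
`U k`. -/
def IsNode (U : ℕ → ℕ) (a k b : ℕ) : Prop :=
  a < k ∧ k < b ∧ (∀ i, a < i → i < b → i ≠ k → U i < U k) ∧ U k < U a ∧ U k < U b

/-- `z` arises on the positions `[l, r)` from the entries of `U` on `(l, r)` and from the additional
entry `M`; at a node `k` the additional entry goes to the right of `k` if `k ∈ S`, and to the left
otherwise. -/
structure IsFilling (U : ℕ → ℕ) (S : Set ℕ) (l r M : ℕ) (z : ℕ → ℕ) : Prop where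
  total : ∀ p, cnt z l r p = cnt U (l + 1) r p + if p ≤ M then 1 else 0
  lower : ∀ j p, l ≤ j → j < r → cnt U (l + 1) (j + 1) p ≤ cnt z l j p
  upper : ∀ j p, l < j → j < r → cnt z l j p ≤ cnt U (l + 1) j p + if p ≤ M then 1 else 0
  left : ∀ a k b, IsNode U a k b → l ≤ a → b ≤ r → k ∈ S →
    ∀ p, cnt z a k p = cnt U (a + 1) (k + 1) p
  right : ∀ a k b, IsNode U a k b → l ≤ a → b ≤ r → k ∉ S → ∀ p, cnt z k b p = cnt U k b p

theorem IsFilling.glue {U : ℕ → ℕ} {S : Set ℕ} {l k r M M₁ M₂ : ℕ} {z₁ z₂ : ℕ → ℕ}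
    (h₁ : IsFilling U S l k M₁ z₁) (h₂ : IsFilling U S k r M₂ z₂) (hlk : l < k) (hkr : k < r)
    (hmax : ∀ i, l < i → i < r → i ≠ k → U i < U k) (hM : U k < M)
    (hS : k ∈ S ∧ M₁ = U k ∧ M₂ = M ∨ k ∉ S ∧ M₁ = M ∧ M₂ = U k) :
    IsFilling U S l r M fun j => if j < k then z₁ j else z₂ j := by
  set z : ℕ → ℕ := fun j => if j < k then z₁ j else z₂ j with hz
  have e₁ : ∀ a b p, b ≤ k → cnt z a b p = cnt z₁ a b p := fun a b p hb =>
    cnt_congr (fun j _ hj => by simp only [hz]; rw [if_pos (by omega)]) p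
  have e₂ : ∀ a b p, k ≤ a → cnt z a b p = cnt z₂ a b p := fun a b p ha =>
    cnt_congr (fun j hj _ => by simp only [hz]; rw [if_neg (by omega)]) p
  have t₁ := h₁.total
  have t₂ := h₂.total
  have hUk : ∀ p, cnt U (l + 1) (k + 1) p = cnt U (l + 1) k p + if p ≤ U k then 1 else 0 :=
    fun p => cnt_succ U (by omega) p
  -- As `U k` is the maximum inside (l, r), a node other than k cannot have k strictly between its
  -- two ends, so it belongs to one of the halves.
  have node : ∀ a b m, IsNode U a m b → l ≤ a → b ≤ r → (m = k ∧ a = l ∧ b = r) ∨ b ≤ k ∨ k ≤ a := by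
    rintro a b m ⟨h1, h2, h3, h4, h5⟩ h6 h7
    rcases lt_trichotomy m k with hm | rfl | hm
    · refine Or.inr (Or.inl ?_)
      by_contra hb
      have := h3 k (by omega) (by omega) (by omega)
      have := hmax m (by omega) (by omega) (by omega)
      omega
    · refine Or.inl ⟨rfl, ?_, ?_⟩
      · by_contra ha
        have := hmax a (by omega) (by omega) (by omega)
        omega
      · by_contra hb
        have := hmax b (by omega) (by omega) (by omega)
        omega
    · refine Or.inr (Or.inr ?_)
      by_contra ha
      have := h3 k (by omega) (by omega) (by omega)
      have := hmax m (by omega) (by omega) (by omega)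
      omega
  constructor
  · intro p
    have := t₁ p
    have := t₂ p
    have := hUk p
    have := cnt_add U (show l + 1 ≤ k + 1 by omega) (show k + 1 ≤ r by omega) p
    rw [cnt_add z hlk.le hkr.le, e₁ _ _ _ le_rfl, e₂ _ _ _ le_rfl]
    rcases hS with ⟨-, rfl, rfl⟩ | ⟨-, rfl, rfl⟩ <;> omega
  · intro j p hj hj'
    rcases lt_or_ge j k with h | h
    · rw [e₁ _ _ _ h.le]
      exact h₁.lower j p hj h
    · rw [cnt_add z hlk.le h, e₁ _ _ _ le_rfl, e₂ _ _ _ le_rfl]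
      have := t₁ p
      have := h₂.lower j p h hj'
      have := hUk p
      have := cnt_add U (show l + 1 ≤ k + 1 by omega) (show k + 1 ≤ j + 1 by omega) p
      rcases hS with ⟨-, rfl, rfl⟩ | ⟨-, rfl, rfl⟩
      · omega
      · split_ifs at * <;> omega
  · intro j p hj hj'
    rcases lt_trichotomy j k with h | rfl | h
    · rw [e₁ _ _ _ h.le]
      have := h₁.upper j p hj h
      rcases hS with ⟨-, rfl, rfl⟩ | ⟨-, rfl, rfl⟩
      · split_ifs at * <;> omega
      · exact this
    · rw [e₁ _ _ _ le_rfl]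
      have := t₁ p
      rcases hS with ⟨-, rfl, rfl⟩ | ⟨-, rfl, rfl⟩
      · split_ifs at * <;> omega
      · omega
    · rw [cnt_add z hlk.le h.le, e₁ _ _ _ le_rfl, e₂ _ _ _ le_rfl]
      have := t₁ p
      have := h₂.upper j p h hj'
      have := hUk p
      have := cnt_add U (show l + 1 ≤ k + 1 by omega) (show k + 1 ≤ j by omega) p
      rcases hS with ⟨-, rfl, rfl⟩ | ⟨-, rfl, rfl⟩ <;> omega
  · intro a m b hn ha hb hm p
    rcases node a b m hn ha hb with ⟨rfl, rfl, rfl⟩ | h | h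
    · rw [e₁ _ _ _ le_rfl, t₁, hUk]
      rcases hS with ⟨-, rfl, rfl⟩ | ⟨h, -⟩
      · rfl
      · exact absurd hm h
    · rw [e₁ _ _ _ (hn.2.1.le.trans h)]
      exact h₁.left a m b hn ha h hm p
    · rw [e₂ _ _ _ h]
      exact h₂.left a m b hn h hb hm p
  · intro a m b hn ha hb hm p
    rcases node a b m hn ha hb with ⟨rfl, rfl, rfl⟩ | h | h
    · rw [e₂ _ _ _ le_rfl, t₂, cnt_add U (Nat.le_succ m) hkr, cnt_single]
      rcases hS with ⟨h, -⟩ | ⟨-, rfl, rfl⟩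
      · exact absurd h hm
      · rw [add_comm]
    · rw [e₁ _ _ _ h]
      exact h₁.right a m b hn ha h hm p
    · rw [e₂ _ _ _ (h.trans hn.1.le)]
      exact h₂.right a m b hn h hb hm p

/-- Recursion along the tree of maxima. If k ∈ S, the left half gets `U k` as its extra entry and so
carries exactly `U` on (l, k]; otherwise the right half gets it and carries `U` on [k, r). -/
theorem exists_isFilling (U : ℕ → ℕ) (S : Set ℕ) {l r M : ℕ} (hlr : l < r)
    (hM : ∀ i, l < i → i < r → U i < M) (hinj : Set.InjOn U (Set.Ioo l r)) :
    ∃ z, IsFilling U S l r M z := by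
  induction hd : r - l using Nat.strong_induction_on generalizing l r M with
  | _ d ih =>
    rcases (Nat.succ_le_of_lt hlr).lt_or_eq with h | h
    · obtain ⟨k, hk, hmax⟩ := Finset.exists_max_image (Finset.Ioo l r) U ⟨l + 1, by simp; omega⟩
      rw [Finset.mem_Ioo] at hk
      have hlt : ∀ i, l < i → i < r → i ≠ k → U i < U k := fun i h1 h2 h3 =>
        lt_of_le_of_ne (hmax i (Finset.mem_Ioo.2 ⟨h1, h2⟩)) fun h4 => h3 (hinj ⟨h1, h2⟩ hk h4)
      have hl : Set.InjOn U (Set.Ioo l k) := hinj.mono (Set.Ioo_subset_Ioo le_rfl hk.2.le)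
      have hr : Set.InjOn U (Set.Ioo k r) := hinj.mono (Set.Ioo_subset_Ioo hk.1.le le_rfl)
      by_cases hS : k ∈ S
      · obtain ⟨z₁, h₁⟩ := ih (k - l) (by omega) (M := U k) hk.1
          (fun i _ _ => hlt i (by omega) (by omega) (by omega)) hl rfl
        obtain ⟨z₂, h₂⟩ := ih (r - k) (by omega) (M := M) hk.2
          (fun i _ _ => hM i (by omega) (by omega)) hr rfl
        exact ⟨_, h₁.glue h₂ hk.1 hk.2 hlt (hM k hk.1 hk.2) (Or.inl ⟨hS, rfl, rfl⟩)⟩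
      · obtain ⟨z₁, h₁⟩ := ih (k - l) (by omega) (M := M) hk.1
          (fun i _ _ => hM i (by omega) (by omega)) hl rfl
        obtain ⟨z₂, h₂⟩ := ih (r - k) (by omega) (M := U k) hk.2
          (fun i _ _ => hlt i (by omega) (by omega) (by omega)) hr rfl
        exact ⟨_, h₁.glue h₂ hk.1 hk.2 hlt (hM k hk.1 hk.2) (Or.inr ⟨hS, rfl, rfl⟩)⟩
    · subst h
      refine ⟨fun _ => M, ⟨fun p => ?_, fun j p h1 h2 => ?_, fun j p h1 h2 => by omega,
        fun a k b h1 h2 h3 => ?_, fun a k b h1 h2 h3 => ?_⟩⟩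
      · rw [cnt_single, cnt_self, zero_add]
      · obtain rfl : j = l := by omega
        rw [cnt_self]; exact Nat.zero_le _
      · have := h1.1; have := h1.2.1; omega
      · have := h1.1; have := h1.2.1; omega

/-- Differences of consecutive counts give the multiplicity of each value, so z takes every value
that a permutation takes. -/
theorem exists_perm_of_cnt {n : ℕ} (v : Equiv.Perm (Fin (n + 1))) (z : ℕ → ℕ)
    (h : ∀ p, cnt z 0 (n + 1) p = cnt (oneLine v) 0 (n + 1) p) :
    ∃ w : Equiv.Perm (Fin (n + 1)), ∀ j < n + 1, oneLine w j = z j := by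
  have hcnt : ∀ (f : ℕ → ℕ) p, cnt f 0 (n + 1) p = cnt f 0 (n + 1) (p + 1) +
      ((Finset.Ico 0 (n + 1)).filter fun j => f j = p).card := by
    intro f p
    rw [cnt, cnt, ← Finset.card_union_of_disjoint, ← Finset.filter_or]
    · congr 1
      refine Finset.filter_congr fun j _ => ?_
      omega
    · refine Finset.disjoint_filter.2 fun j _ h1 h2 => ?_
      omega
  have hle : ∀ j < n + 1, z j < n + 1 := by
    intro j hj
    by_contra hz
    have h1 : cnt (oneLine v) 0 (n + 1) (n + 1) = 0 :=
      cnt_eq_zero fun j _ _ => Nat.lt_succ_iff.2 (oneLine_le v j)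
    rw [← h, cnt, Finset.card_eq_zero, Finset.filter_eq_empty_iff] at h1
    exact h1 (Finset.mem_Ico.2 ⟨Nat.zero_le _, hj⟩) (not_lt.1 hz)
  let g : Fin (n + 1) → Fin (n + 1) := fun j => ⟨z j, hle j j.2⟩
  have hsurj : Function.Surjective g := by
    intro p
    have h1 := hcnt z p
    have h2 := hcnt (oneLine v) p
    have h3 : 0 < ((Finset.Ico 0 (n + 1)).filter fun j => oneLine v j = p).card := by
      refine Finset.card_pos.2 ⟨(v.symm p : ℕ), ?_⟩
      rw [Finset.mem_filter, Finset.mem_Ico, oneLine_of_lt _ (v.symm p).2]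
      exact ⟨⟨Nat.zero_le _, (v.symm p).2⟩, by simp⟩
    rw [h, h] at h1
    obtain ⟨j, hj⟩ := Finset.card_pos.1 (show
      0 < ((Finset.Ico 0 (n + 1)).filter fun j => z j = p).card by omega)
    rw [Finset.mem_filter, Finset.mem_Ico] at hj
    exact ⟨⟨j, hj.1.2⟩, Fin.ext hj.2⟩
  refine ⟨Equiv.ofBijective g (Finite.surjective_iff_bijective.1 hsurj), fun j hj => ?_⟩
  rw [oneLine_of_lt _ hj]
  rfl

/-- The interval contains the permutations with prescribed choices at all nodes. -/
theorem exists_mem_interval {n : ℕ} (u : Equiv.Perm (Fin n)) (S : Set ℕ) :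
    ∃ z : Equiv.Perm (Fin (n + 1)), SeqBounds n (paddedSeq u) (oneLine z) ∧
      ∀ a k b, IsNode (paddedSeq u) a k b → b ≤ n + 1 →
        (k ∈ S → ∀ p, cnt (oneLine z) a k p = cnt (paddedSeq u) (a + 1) (k + 1) p) ∧
        (k ∉ S → ∀ p, cnt (oneLine z) k b p = cnt (paddedSeq u) k b p) := by
  set U := paddedSeq u with hU
  have hU0 : U 0 = n := paddedSeq_of_not u (by omega)
  have hUn : U (n + 1) = n := paddedSeq_of_not u (by omega)
  obtain ⟨z, hz⟩ := exists_isFilling U S (l := 0) (r := n + 1) (M := n) (Nat.succ_pos n)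
    (fun i h1 h2 => paddedSeq_lt u h1 (by omega))
    (fun i hi j hj h => paddedSeq_inj u hi.1 (Nat.lt_succ_iff.1 hi.2) hj.1
      (Nat.lt_succ_iff.1 hj.2) h)
  have htot : ∀ p, cnt z 0 (n + 1) p = cnt U 1 (n + 2) p := fun p => by
    rw [hz.total, cnt_succ U (by omega : 1 ≤ n + 1), hUn, zero_add]
  obtain ⟨w, hw⟩ := exists_perm_of_cnt (addTail u) z fun p => by
    rw [htot, ← cnt_shift]
    exact cnt_congr (fun j _ hj => (oneLine_addTail u hj).symm) p
  have hwz : ∀ a b p, b ≤ n + 1 → cnt (oneLine w) a b p = cnt z a b p := fun a b p hb =>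
    cnt_congr (fun j _ hj => hw j (by omega)) p
  refine ⟨w, fun k hk p => ?_, fun a k b hn hb => ⟨fun hS p => ?_, fun hS p => ?_⟩⟩
  · rw [hwz _ _ _ hk]
    rcases Nat.eq_zero_or_pos k with rfl | hk0
    · simp [cnt_self]
    have h1 : cnt U 0 k p = cnt U 1 k p + if p ≤ n then 1 else 0 := by
      rw [cnt_add U (Nat.zero_le 1) hk0, cnt_single, hU0, add_comm]
    rw [h1]
    rcases hk.lt_or_eq with h | rfl
    · exact ⟨hz.lower k p (Nat.zero_le _) h, hz.upper k p hk0 h⟩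
    · exact ⟨(htot p).symm.le, (hz.total p).le⟩
  · rw [hwz _ _ _ (by have := hn.2.1; omega)]
    exact hz.left a k b hn (Nat.zero_le _) hb hS p
  · rw [hwz _ _ _ hb]
    exact hz.right a k b hn (Nat.zero_le _) hb hS p

/-! ### Normal fans of combinatorial cubes -/

/-- The polytope `P` is described by pairs of inequalities `A k ≤ ⟨a k, p⟩`, `B k ≤ ⟨b k, p⟩`: no
point attains equality in both inequalities of a pair, each choice of one inequality from each pair is
attained simultaneously, and every class in `N ⊗ ℝ` is a nonnegative combination of normals from
different pairs. -/
structure IsCubical {n : ℕ} {ι : Type} [Fintype ι] (P : Set (Fin (n + 1) → ℝ))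
    (a b : ι → Fin (n + 1) → ℝ) (A B : ι → ℝ) : Prop where
  left : ∀ p ∈ P, ∀ k, A k ≤ a k ⬝ᵥ p
  right : ∀ p ∈ P, ∀ k, B k ≤ b k ⬝ᵥ p
  not_both : ∀ p ∈ P, ∀ k, a k ⬝ᵥ p = A k → b k ⬝ᵥ p ≠ B k
  vertex : ∀ S : Set ι, ∃ p ∈ P, (∀ k ∈ S, a k ⬝ᵥ p = A k) ∧ ∀ k ∉ S, b k ⬝ᵥ p = B k
  sum_eq : ∀ p ∈ P, ∀ q ∈ P, ∑ i, p i = ∑ i, q i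
  complete : ∀ x : NReal n, ∃ α β : ι → ℝ, (∀ k, 0 ≤ α k) ∧ (∀ k, 0 ≤ β k) ∧
    (∀ k, α k = 0 ∨ β k = 0) ∧
    x = ∑ k, (α k • (diagonalLine n).mkQ (a k) + β k • (diagonalLine n).mkQ (b k))

/-- Pairing with p - q is well defined on N ⊗ ℝ, as p - q has coordinate sum 0. -/
theorem dotProduct_sub_eq_of_mkQ_eq {n : ℕ} {y y' p q : Fin (n + 1) → ℝ}
    (h : (diagonalLine n).mkQ y = (diagonalLine n).mkQ y') (hpq : ∑ i, p i = ∑ i, q i) :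
    y ⬝ᵥ p - y ⬝ᵥ q = y' ⬝ᵥ p - y' ⬝ᵥ q := by
  rw [Submodule.mkQ_apply, Submodule.mkQ_apply, Submodule.Quotient.eq, diagonalLine,
    Submodule.mem_span_singleton] at h
  obtain ⟨c, hc⟩ := h
  have hy : y = y' + c • fun _ => (1 : ℝ) := by rw [hc]; abel
  have h1 : ∀ r : Fin (n + 1) → ℝ, (fun _ : Fin (n + 1) => (1 : ℝ)) ⬝ᵥ r = ∑ i, r i := fun r => by
    simp [dotProduct]
  rw [hy, add_dotProduct, add_dotProduct, smul_dotProduct, smul_dotProduct, h1, h1, hpq]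
  ring

theorem mem_normalCone {n : ℕ} {P F : Set (Fin (n + 1) → ℝ)} {x : NReal n} :
    x ∈ normalCone P F ↔
      ∃ y, (∀ p ∈ P, ∀ f ∈ F, y ⬝ᵥ f ≤ y ⬝ᵥ p) ∧ (diagonalLine n).mkQ y = x := by
  rw [normalCone, PointedCone.mem_map]
  refine exists_congr fun y => and_congr_left fun _ => ?_
  rw [PointedCone.mem_dual]
  constructor
  · intro h p hp f hf
    have := h (Set.sub_mem_sub hp hf)
    rw [dotProductBilin_apply_apply, sub_dotProduct, dotProduct_comm p, dotProduct_comm f] at this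
    linarith
  · rintro h _ ⟨p, hp, f, hf, rfl⟩
    have := h p hp f hf
    rw [dotProductBilin_apply_apply, sub_dotProduct, dotProduct_comm p, dotProduct_comm f]
    linarith

namespace IsCubical

variable {n : ℕ} {ι : Type} [Fintype ι] {P : Set (Fin (n + 1) → ℝ)}
  {a b : ι → Fin (n + 1) → ℝ} {A B : ι → ℝ}

/-- The face on which the inequalities selected by `S` and `T` are equalities. -/
def face (P : Set (Fin (n + 1) → ℝ)) (a b : ι → Fin (n + 1) → ℝ) (A B : ι → ℝ)
    (S T : Set ι) : Set (Fin (n + 1) → ℝ) :=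
  {p | p ∈ P ∧ (∀ k ∈ S, a k ⬝ᵥ p = A k) ∧ ∀ k ∈ T, b k ⬝ᵥ p = B k}

theorem sub_eq_sum (h : IsCubical P a b A B) {α β : ι → ℝ} {y : Fin (n + 1) → ℝ}
    (hy : (diagonalLine n).mkQ y =
      ∑ k, (α k • (diagonalLine n).mkQ (a k) + β k • (diagonalLine n).mkQ (b k)))
    {p q : Fin (n + 1) → ℝ} (hp : p ∈ P) (hq : q ∈ P) :
    y ⬝ᵥ p - y ⬝ᵥ q =
      ∑ k, (α k * (a k ⬝ᵥ p - a k ⬝ᵥ q) + β k * (b k ⬝ᵥ p - b k ⬝ᵥ q)) := by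
  have hy' : (diagonalLine n).mkQ y =
      (diagonalLine n).mkQ (∑ k, (α k • a k + β k • b k)) := by
    simp only [map_sum, map_add, map_smul, hy]
  rw [dotProduct_sub_eq_of_mkQ_eq hy' (h.sum_eq p hp q hq), sum_dotProduct, sum_dotProduct,
    ← Finset.sum_sub_distrib]
  refine Finset.sum_congr rfl fun k _ => ?_
  simp only [add_dotProduct, smul_dotProduct, smul_eq_mul]
  ring

theorem minimizers_eq_face (h : IsCubical P a b A B) {α β : ι → ℝ} (hα : ∀ k, 0 ≤ α k)
    (hβ : ∀ k, 0 ≤ β k) (hαβ : ∀ k, α k = 0 ∨ β k = 0) {y : Fin (n + 1) → ℝ}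
    (hy : (diagonalLine n).mkQ y =
      ∑ k, (α k • (diagonalLine n).mkQ (a k) + β k • (diagonalLine n).mkQ (b k))) :
    {p | p ∈ P ∧ ∀ q ∈ P, y ⬝ᵥ p ≤ y ⬝ᵥ q} = face P a b A B {k | 0 < α k} {k | 0 < β k} := by
  ext p
  refine and_congr_right fun hp => ?_
  constructor
  · intro hmin
    -- This q makes every inequality with a positive coefficient tight. So every term of y·p - y·q
    -- is nonnegative, and minimality of p makes all of them vanish.
    obtain ⟨q, hq, h1, h2⟩ := h.vertex {k | 0 < α k}
    have hs := h.sub_eq_sum hy hp hq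
    have hnn : ∀ k, 0 ≤ α k * (a k ⬝ᵥ p - a k ⬝ᵥ q) ∧ 0 ≤ β k * (b k ⬝ᵥ p - b k ⬝ᵥ q) := by
      intro k
      constructor
      · rcases (hα k).eq_or_lt with h0 | h0
        · rw [← h0, zero_mul]
        · rw [h1 k h0]
          exact mul_nonneg (hα k) (sub_nonneg.2 (h.left p hp k))
      · rcases hαβ k with h0 | h0
        · rw [h2 k (by simp [h0])]
          exact mul_nonneg (hβ k) (sub_nonneg.2 (h.right p hp k))
        · rw [h0, zero_mul]
    have h0 : ∑ k, (α k * (a k ⬝ᵥ p - a k ⬝ᵥ q) + β k * (b k ⬝ᵥ p - b k ⬝ᵥ q)) = 0 := by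
      refine le_antisymm ?_ (Finset.sum_nonneg fun k _ => add_nonneg (hnn k).1 (hnn k).2)
      rw [← hs]
      exact sub_nonpos.2 (hmin q hq)
    rw [Finset.sum_eq_zero_iff_of_nonneg fun k _ => add_nonneg (hnn k).1 (hnn k).2] at h0
    have h00 : ∀ k, α k * (a k ⬝ᵥ p - a k ⬝ᵥ q) = 0 ∧ β k * (b k ⬝ᵥ p - b k ⬝ᵥ q) = 0 := fun k =>
      (add_eq_zero_iff_of_nonneg (hnn k).1 (hnn k).2).1 (h0 k (Finset.mem_univ k))
    refine ⟨fun k hk => ?_, fun k (hk : 0 < β k) => ?_⟩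
    · rcases mul_eq_zero.1 (h00 k).1 with h3 | h3
      · exact absurd h3 (ne_of_gt hk)
      · rw [← h1 k hk]; linarith
    · rcases mul_eq_zero.1 (h00 k).2 with h3 | h3
      · exact absurd h3 hk.ne'
      · have : α k = 0 := (hαβ k).resolve_right hk.ne'
        rw [← h2 k (by simp [this])]; linarith
  · rintro ⟨h1, h2⟩ q hq
    have hs := h.sub_eq_sum hy hq hp
    have : 0 ≤ ∑ k, (α k * (a k ⬝ᵥ q - a k ⬝ᵥ p) + β k * (b k ⬝ᵥ q - b k ⬝ᵥ p)) := by
      refine Finset.sum_nonneg fun k _ => add_nonneg ?_ ?_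
      · rcases (hα k).eq_or_lt with h0 | h0
        · rw [← h0, zero_mul]
        · rw [h1 k h0]
          exact mul_nonneg (hα k) (sub_nonneg.2 (h.left q hq k))
      · rcases (hβ k).eq_or_lt with h0 | h0
        · rw [← h0, zero_mul]
        · rw [h2 k h0]
          exact mul_nonneg (hβ k) (sub_nonneg.2 (h.right q hq k))
    linarith

theorem exists_mem_face (h : IsCubical P a b A B) {S T : Set ι} (hST : Disjoint S T) :
    (face P a b A B S T).Nonempty := by
  obtain ⟨p, hp, h1, h2⟩ := h.vertex S
  exact ⟨p, hp, h1, fun k hk => h2 k fun hk' => Set.disjoint_left.1 hST hk' hk⟩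

/-- For the inclusion into the hull, expand y in normals from different pairs. Every point of the
face makes tight each inequality with a positive coefficient. A vertex of the face whose free
choices are opposite to a given index then rules out positive coefficients outside S and T. -/
theorem normalCone_face (h : IsCubical P a b A B) {S T : Set ι} (hST : Disjoint S T) :
    normalCone P (face P a b A B S T) =
      PointedCone.hull ℝ ((fun k => (diagonalLine n).mkQ (a k)) '' S ∪
        (fun k => (diagonalLine n).mkQ (b k)) '' T) := by
  apply le_antisymm
  · intro x hx
    obtain ⟨y, hy, rfl⟩ := mem_normalCone.1 hx
    obtain ⟨α, β, hα, hβ, hαβ, hsum⟩ := h.complete ((diagonalLine n).mkQ y)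
    have hface : ∀ p ∈ face P a b A B S T,
        p ∈ face P a b A B {k | 0 < α k} {k | 0 < β k} := fun p hp => by
      rw [← h.minimizers_eq_face hα hβ hαβ hsum]
      exact ⟨hp.1, fun q hq => hy q hq p hp⟩
    have hS : ∀ k, 0 < α k → k ∈ S := fun k hk => by
      by_contra hkS
      obtain ⟨p, hp, h1, h2⟩ := h.vertex S
      have := hface p ⟨hp, h1, fun k hk => h2 k fun hk' => Set.disjoint_left.1 hST hk' hk⟩
      exact h.not_both p hp k (this.2.1 k hk) (h2 k hkS)
    have hT : ∀ k, 0 < β k → k ∈ T := fun k hk => by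
      by_contra hkT
      obtain ⟨p, hp, h1, h2⟩ := h.vertex Tᶜ
      have := hface p ⟨hp, fun k hk => h1 k fun hk' => Set.disjoint_left.1 hST hk hk',
        fun k hk => h2 k (not_not.2 hk)⟩
      exact h.not_both p hp k (h1 k hkT) (this.2.2 k hk)
    rw [hsum]
    refine Submodule.sum_mem _ fun k _ => Submodule.add_mem _ ?_ ?_
    · rcases (hα k).eq_or_lt with h0 | h0
      · rw [← h0, zero_smul]; exact Submodule.zero_mem _
      · exact PointedCone.smul_mem _ (hα k)
          (PointedCone.subset_hull (Or.inl ⟨k, hS k h0, rfl⟩))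
    · rcases (hβ k).eq_or_lt with h0 | h0
      · rw [← h0, zero_smul]; exact Submodule.zero_mem _
      · exact PointedCone.smul_mem _ (hβ k)
          (PointedCone.subset_hull (Or.inr ⟨k, hT k h0, rfl⟩))
  · refine Submodule.span_le.2 ?_
    rintro _ (⟨k, hk, rfl⟩ | ⟨k, hk, rfl⟩)
    · refine mem_normalCone.2 ⟨a k, fun p hp f hf => ?_, rfl⟩
      rw [hf.2.1 k hk]
      exact h.left p hp k
    · refine mem_normalCone.2 ⟨b k, fun p hp f hf => ?_, rfl⟩
      rw [hf.2.2 k hk]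
      exact h.right p hp k

/-- A class that is a selected normal of one of the inequalities is minimized on the face. -/
theorem le_of_mem_generators (h : IsCubical P a b A B) {S T : Set ι} {x : NReal n}
    (hx : x ∈ (fun k => (diagonalLine n).mkQ (a k)) '' S ∪
      (fun k => (diagonalLine n).mkQ (b k)) '' T) {f : Fin (n + 1) → ℝ}
    (hf : f ∈ face P a b A B S T) {y : Fin (n + 1) → ℝ} (hy : (diagonalLine n).mkQ y = x)
    {p : Fin (n + 1) → ℝ} (hp : p ∈ P) : y ⬝ᵥ f ≤ y ⬝ᵥ p := by
  rcases hx with ⟨k, hk, rfl⟩ | ⟨k, hk, rfl⟩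
  · have h1 := dotProduct_sub_eq_of_mkQ_eq hy (h.sum_eq p hp f hf.1)
    have h2 := h.left p hp k
    rw [← hf.2.1 k hk] at h2
    linarith
  · have h1 := dotProduct_sub_eq_of_mkQ_eq hy (h.sum_eq p hp f hf.1)
    have h2 := h.right p hp k
    rw [← hf.2.2 k hk] at h2
    linarith

/-- Normals with different indices are not known to have different classes, so membership among the
generators need not mean k ∈ S or k ∈ T. Instead, both normals of the pair would be minimized on the
nonempty face, making both inequalities tight. -/
theorem admissible (h : IsCubical P a b A B) {S T : Set ι} (hST : Disjoint S T) (k : ι)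
    (ha : (diagonalLine n).mkQ (a k) ∈ (fun k => (diagonalLine n).mkQ (a k)) '' S ∪
      (fun k => (diagonalLine n).mkQ (b k)) '' T)
    (hb : (diagonalLine n).mkQ (b k) ∈ (fun k => (diagonalLine n).mkQ (a k)) '' S ∪
      (fun k => (diagonalLine n).mkQ (b k)) '' T) : False := by
  obtain ⟨f, hf⟩ := h.exists_mem_face hST
  obtain ⟨p, hp, h1, -⟩ := h.vertex Set.univ
  obtain ⟨q, hq, -, h2⟩ := h.vertex ∅
  have h3 := h.le_of_mem_generators ha hf rfl hp
  have h4 := h.le_of_mem_generators hb hf rfl hq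
  rw [h1 k (Set.mem_univ k)] at h3
  rw [h2 k (Set.notMem_empty k)] at h4
  exact h.not_both f hf.1 k (le_antisymm h3 (h.left f hf.1 k))
    (le_antisymm h4 (h.right f hf.1 k))

theorem isExposed_face (h : IsCubical P a b A B) {S T : Set ι} (hST : Disjoint S T) :
    IsExposed ℝ P (face P a b A B S T) := by
  classical
  intro _
  set α : ι → ℝ := fun k => if k ∈ S then 1 else 0 with hα
  set β : ι → ℝ := fun k => if k ∈ T then 1 else 0 with hβ
  set y : Fin (n + 1) → ℝ := ∑ k, (α k • a k + β k • b k) with hy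
  have key := h.minimizers_eq_face (α := α) (β := β) (y := y)
    (fun k => by simp only [hα]; split_ifs <;> norm_num)
    (fun k => by simp only [hβ]; split_ifs <;> norm_num)
    (fun k => by
      by_cases hk : k ∈ S
      · exact Or.inr (if_neg (Set.disjoint_left.1 hST hk))
      · exact Or.inl (if_neg hk))
    (by simp only [hy, map_sum, map_add, map_smul])
  have hS : {k | 0 < α k} = S := by
    ext k; simp only [hα, Set.mem_ofPred_eq]; split_ifs with hk <;> simp [hk]
  have hT : {k | 0 < β k} = T := by
    ext k; simp only [hβ, Set.mem_ofPred_eq]; split_ifs with hk <;> simp [hk]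
  rw [hS, hT] at key
  -- The sign turns minimizers into the maximizers used by `IsExposed`.
  refine ⟨LinearMap.toContinuousLinearMap (-(dotProductBilin ℝ ℝ y)), ?_⟩
  rw [← key]
  simp

theorem normalFan_eq (h : IsCubical P a b A B) :
    normalFan P = {σ | ∃ Q : Set (NReal n),
      (∀ x ∈ Q, ∃ k, x = (diagonalLine n).mkQ (a k) ∨ x = (diagonalLine n).mkQ (b k)) ∧
      (∀ k, ¬ ((diagonalLine n).mkQ (a k) ∈ Q ∧ (diagonalLine n).mkQ (b k) ∈ Q)) ∧
      σ = PointedCone.hull ℝ Q} := by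
  ext σ
  constructor
  · rintro ⟨F, hF, hexp, rfl⟩
    obtain ⟨l, hl⟩ := hexp hF
    set y : Fin (n + 1) → ℝ := fun i => - l (Pi.single i 1) with hy
    have hly : ∀ p, l p = - (y ⬝ᵥ p) := by
      intro p
      conv_lhs => rw [pi_eq_sum_univ' p]
      rw [map_sum, dotProduct, ← Finset.sum_neg_distrib]
      refine Finset.sum_congr rfl fun i _ => ?_
      rw [map_smul, smul_eq_mul, hy]
      ring
    obtain ⟨α, β, hα, hβ, hαβ, hsum⟩ := h.complete ((diagonalLine n).mkQ y)
    have hface := h.minimizers_eq_face hα hβ hαβ hsum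
    have hFf : F = face P a b A B {k | 0 < α k} {k | 0 < β k} := by
      rw [← hface, hl]
      simp only [hly, neg_le_neg_iff]
    have hST : Disjoint {k | 0 < α k} {k | 0 < β k} :=
      Set.disjoint_left.2 fun k (h1 : 0 < α k) (h2 : 0 < β k) => by
        rcases hαβ k with h3 | h3 <;> linarith
    rw [hFf]
    refine ⟨_, ?_, fun k hk => h.admissible hST k hk.1 hk.2, h.normalCone_face hST⟩
    rintro _ (⟨k, -, rfl⟩ | ⟨k, -, rfl⟩)
    · exact ⟨k, Or.inl rfl⟩
    · exact ⟨k, Or.inr rfl⟩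
  · rintro ⟨Q, h1, h2, rfl⟩
    -- All indices whose class lies in Q are selected, which recovers Q exactly even if classes
    -- coincide.
    have hST : Disjoint {k | (diagonalLine n).mkQ (a k) ∈ Q} {k | (diagonalLine n).mkQ (b k) ∈ Q} :=
      Set.disjoint_left.2 fun k hk hk' => h2 k ⟨hk, hk'⟩
    have hQ : Q = (fun k => (diagonalLine n).mkQ (a k)) '' {k | (diagonalLine n).mkQ (a k) ∈ Q} ∪
        (fun k => (diagonalLine n).mkQ (b k)) '' {k | (diagonalLine n).mkQ (b k) ∈ Q} := by
      ext x
      constructor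
      · intro hx
        obtain ⟨k, rfl | rfl⟩ := h1 x hx
        · exact Or.inl ⟨k, hx, rfl⟩
        · exact Or.inr ⟨k, hx, rfl⟩
      · rintro (⟨k, hk, rfl⟩ | ⟨k, hk, rfl⟩)
        · exact hk
        · exact hk
    refine ⟨_, h.exists_mem_face hST, h.isExposed_face hST, ?_⟩
    rw [h.normalCone_face hST, ← hQ]

end IsCubical

/-! ### The polytope of the interval -/

/-- The vector `e_1 + ⋯ + e_i`. -/
def initVec (n i : ℕ) : Fin (n + 1) → ℝ := fun j => if (j : ℕ) < i then 1 else 0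

theorem mkQ_initVec (n i : ℕ) : (diagonalLine n).mkQ (initVec n i) = varpi n i := rfl

theorem varpi_zero (n : ℕ) : varpi n 0 = 0 := by
  rw [← mkQ_initVec, show initVec n 0 = 0 from funext fun j => by simp [initVec], map_zero]

theorem varpi_of_ge {n i : ℕ} (h : n + 1 ≤ i) : varpi n i = 0 := by
  rw [← mkQ_initVec, Submodule.mkQ_apply, Submodule.Quotient.mk_eq_zero, diagonalLine]
  have : initVec n i = fun _ => 1 := funext fun j => if_pos (by omega)
  rw [this]
  exact Submodule.mem_span_singleton_self _

theorem sum_Ico_sub_succ (y : ℕ → ℝ) {j m : ℕ} (h : j ≤ m) :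
    ∑ k ∈ Finset.Ico (j + 1) (m + 1), (y (k - 1) - y k) = y j - y m := by
  induction m, h using Nat.le_induction with
  | base => simp
  | succ m hm ih =>
    rw [Finset.sum_Ico_succ_top (by omega), ih, Nat.add_sub_cancel]
    ring

theorem exists_eq_sum_varpi {n : ℕ} (x : NReal n) :
    ∃ c : ℕ → ℝ, x = ∑ k ∈ Finset.Icc 1 n, c k • varpi n k := by
  obtain ⟨y, rfl⟩ := (diagonalLine n).mkQ_surjective x
  set y' : ℕ → ℝ := fun j => if h : j < n + 1 then y ⟨j, h⟩ else 0 with hy'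
  -- Summation by parts; the sum differs from y by the constant vector with value `y' n`.
  refine ⟨fun k => y' (k - 1) - y' k, ?_⟩
  simp only [← mkQ_initVec, ← map_smul, ← map_sum]
  rw [Submodule.mkQ_apply, Submodule.mkQ_apply, Submodule.Quotient.eq, diagonalLine,
    Submodule.mem_span_singleton]
  refine ⟨y' n, ?_⟩
  ext j
  have hj := j.2
  have h1 : y j = y' j := by simp only [hy', dif_pos hj, Fin.eta]
  have h2 : (∑ k ∈ Finset.Icc 1 n, (y' (k - 1) - y' k) • initVec n k) j = y' j - y' n := by
    rw [Finset.sum_apply, ← Finset.Ico_succ_right_eq_Icc,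
      ← Finset.sum_Ico_consecutive _ (show 1 ≤ (j : ℕ) + 1 by omega)
        (show (j : ℕ) + 1 ≤ Order.succ n from hj), Finset.sum_eq_zero, zero_add]
    · rw [← sum_Ico_sub_succ y' (Nat.lt_succ_iff.1 hj)]
      refine Finset.sum_congr rfl fun k hk => ?_
      rw [Finset.mem_Ico] at hk
      rw [Pi.smul_apply, initVec, if_pos (by omega), smul_eq_mul, mul_one]
    · intro k hk
      rw [Finset.mem_Ico] at hk
      rw [Pi.smul_apply, initVec, if_neg (by omega), smul_zero]
  rw [Pi.sub_apply, h2, h1]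
  simp

/-- Eliminate the position k with the smallest `U k`: the sign of its coefficient decides which
normal of the pair absorbs it, and the remainder is a multiple of ϖ at a neighbour. That neighbour
has a larger value of `U`, so it is still in s, or it is an end position where ϖ vanishes. -/
theorem exists_nonneg_combination {n : ℕ} {U lam rho : ℕ → ℕ}
    (hnode : ∀ k ∈ Finset.Icc 1 n, IsNode U (lam k) k (rho k)) (s : Finset ℕ)
    (hs : s ⊆ Finset.Icc 1 n) (hup : ∀ k ∈ s, ∀ j ∈ Finset.Icc 1 n, U k < U j → j ∈ s)
    (c : ℕ → ℝ) :
    ∃ α β : ℕ → ℝ, (∀ k, 0 ≤ α k) ∧ (∀ k, 0 ≤ β k) ∧ (∀ k, α k = 0 ∨ β k = 0) ∧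
      ∑ k ∈ s, c k • varpi n k = ∑ k ∈ s,
        (α k • (varpi n k - varpi n (lam k)) + β k • (varpi n (rho k) - varpi n k)) := by
  classical
  induction s using Finset.induction_on_min_value U generalizing c with
  | empty => exact ⟨0, 0, fun _ => le_rfl, fun _ => le_rfl, fun _ => Or.inl rfl, by simp⟩
  | insert k s hks hmin ih =>
    have hsub : s ⊆ Finset.Icc 1 n := fun j hj => hs (Finset.mem_insert_of_mem hj)
    have hk := hs (Finset.mem_insert_self k s)
    obtain ⟨h1, h2, h3, h4, h5⟩ := hnode k hk
    have hup' : ∀ i ∈ s, ∀ j ∈ Finset.Icc 1 n, U i < U j → j ∈ s := by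
      intro i hi j hj hij
      rcases Finset.mem_insert.1 (hup i (Finset.mem_insert_of_mem hi) j hj hij) with rfl | h
      · exact absurd hij (not_lt.2 (hmin i hi))
      · exact h
    have hshift : ∀ (m : ℕ) (d : ℝ), U k < U m → ∃ c' : ℕ → ℝ,
        d • varpi n m + ∑ j ∈ s, c j • varpi n j = ∑ j ∈ s, c' j • varpi n j := by
      intro m d hm
      by_cases hmem : m ∈ Finset.Icc 1 n
      · have hms : m ∈ s := (Finset.mem_insert.1
          (hup k (Finset.mem_insert_self k s) m hmem hm)).resolve_left (by rintro rfl; omega)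
        refine ⟨fun j => (if j = m then d else 0) + c j, ?_⟩
        simp only [add_smul, Finset.sum_add_distrib, ite_smul, zero_smul, Finset.sum_ite_eq',
          if_pos hms]
      · have h0 : varpi n m = 0 := by
          rw [Finset.mem_Icc] at hmem
          rcases Nat.eq_zero_or_pos m with rfl | h
          · exact varpi_zero n
          · exact varpi_of_ge (by omega)
        exact ⟨c, by rw [h0, smul_zero, zero_add]⟩
    have hne : ∀ j ∈ s, j ≠ k := fun j hj h => hks (h ▸ hj)
    rcases le_total 0 (c k) with hc | hc
    · obtain ⟨c', hc'⟩ := hshift (lam k) (c k) h4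
      obtain ⟨α, β, hα, hβ, hαβ, hsum⟩ := ih hsub hup' c'
      refine ⟨fun j => if j = k then c k else α j, fun j => if j = k then 0 else β j,
        fun j => ?_, fun j => ?_, fun j => ?_, ?_⟩
      · dsimp only; split_ifs
        exacts [hc, hα j]
      · dsimp only; split_ifs
        exacts [le_rfl, hβ j]
      · dsimp only; split_ifs
        exacts [Or.inr rfl, hαβ j]
      · rw [Finset.sum_insert hks, Finset.sum_insert hks]
        have hrest : ∀ j ∈ s, (if j = k then c k else α j) • (varpi n j - varpi n (lam j)) +
            (if j = k then 0 else β j) • (varpi n (rho j) - varpi n j) =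
            α j • (varpi n j - varpi n (lam j)) + β j • (varpi n (rho j) - varpi n j) :=
          fun j hj => by rw [if_neg (hne j hj), if_neg (hne j hj)]
        dsimp only
        rw [if_pos rfl, if_pos rfl, Finset.sum_congr rfl hrest, ← hsum, ← hc']
        module
    · obtain ⟨c', hc'⟩ := hshift (rho k) (c k) h5
      obtain ⟨α, β, hα, hβ, hαβ, hsum⟩ := ih hsub hup' c'
      refine ⟨fun j => if j = k then 0 else α j, fun j => if j = k then - c k else β j,
        fun j => ?_, fun j => ?_, fun j => ?_, ?_⟩
      · dsimp only; split_ifs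
        exacts [le_rfl, hα j]
      · dsimp only; split_ifs
        exacts [neg_nonneg.2 hc, hβ j]
      · dsimp only; split_ifs
        exacts [Or.inl rfl, hαβ j]
      · rw [Finset.sum_insert hks, Finset.sum_insert hks]
        have hrest : ∀ j ∈ s, (if j = k then 0 else α j) • (varpi n j - varpi n (lam j)) +
            (if j = k then -c k else β j) • (varpi n (rho j) - varpi n j) =
            α j • (varpi n j - varpi n (lam j)) + β j • (varpi n (rho j) - varpi n j) :=
          fun j hj => by rw [if_neg (hne j hj), if_neg (hne j hj)]
        dsimp only
        rw [if_pos rfl, if_pos rfl, Finset.sum_congr rfl hrest, ← hsum, ← hc']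
        module

/-- The vector is the indicator of [a, b). The summand b - a appears because `permPoint` has values
from 1 and `oneLine` from 0. -/
theorem initVec_sub_dotProduct_permPoint {n : ℕ} (z : Equiv.Perm (Fin (n + 1))) {a b : ℕ}
    (hab : a ≤ b) (hb : b ≤ n + 1) :
    (initVec n b - initVec n a) ⬝ᵥ permPoint z =
      ((∑ j ∈ Finset.Ico a b, oneLine z j + (b - a) : ℕ) : ℝ) := by
  have h1 : ∀ j : Fin (n + 1), (initVec n b - initVec n a) j * permPoint z j =
      (fun j : ℕ => if j ∈ Finset.Ico a b then ((oneLine z j : ℕ) : ℝ) + 1 else 0) j := by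
    intro j
    simp only [Pi.sub_apply, initVec, permPoint, Finset.mem_Ico, oneLine_of_lt z j.2, Fin.eta]
    split_ifs <;> first | omega | simp
  rw [dotProduct, Finset.sum_congr rfl fun j _ => h1 j,
    Fin.sum_univ_eq_sum_range
      (fun j => if j ∈ Finset.Ico a b then ((oneLine z j : ℕ) : ℝ) + 1 else 0),
    ← Finset.sum_filter]
  have h2 : (Finset.range (n + 1)).filter (fun j => j ∈ Finset.Ico a b) = Finset.Ico a b := by
    ext j; simp only [Finset.mem_filter, Finset.mem_range, Finset.mem_Ico]; omega
  rw [h2, Finset.sum_add_distrib]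
  simp

theorem le_dotProduct_of_mem_convexHull {n : ℕ} {s : Set (Fin (n + 1) → ℝ)}
    {y : Fin (n + 1) → ℝ} {c : ℝ} (h : ∀ p ∈ s, c ≤ y ⬝ᵥ p) :
    ∀ p ∈ convexHull ℝ s, c ≤ y ⬝ᵥ p := by
  have hc : Convex ℝ {p : Fin (n + 1) → ℝ | c ≤ y ⬝ᵥ p} :=
    convex_halfSpace_ge (dotProductBilin ℝ ℝ y).isLinear c
  exact fun p hp => convexHull_min h hc hp

theorem sum_eq_of_mem_convexHull {n : ℕ} {s : Set (Equiv.Perm (Fin (n + 1)))}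
    {p : Fin (n + 1) → ℝ} (hp : p ∈ convexHull ℝ (permPoint '' s)) :
    ∑ i, p i = ∑ i : Fin (n + 1), (((i : ℕ) : ℝ) + 1) := by
  have hc : Convex ℝ {p : Fin (n + 1) → ℝ | ∑ i, p i = ∑ i : Fin (n + 1), (((i : ℕ) : ℝ) + 1)} :=
    convex_hyperplane ⟨fun p q => by simp [Finset.sum_add_distrib],
      fun c p => by simp [Finset.mul_sum]⟩ _
  refine convexHull_min ?_ hc hp
  rintro _ ⟨z, -, rfl⟩
  exact Equiv.sum_comp z fun i : Fin (n + 1) => ((i : ℕ) : ℝ) + 1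

theorem paddedSeq_le_zero {n : ℕ} (u : Equiv.Perm (Fin n)) (j : ℕ) :
    paddedSeq u j ≤ paddedSeq u 0 := by
  rw [paddedSeq_of_not u (j := 0) (by omega)]
  exact paddedSeq_le u j

theorem SeqBounds.lt_sum {n : ℕ} {U z : ℕ → ℕ} (h : SeqBounds n U z) (h0 : ∀ j, U j ≤ U 0)
    {a k b : ℕ} (hn : IsNode U a k b) (hb : b ≤ n + 1) :
    ∑ j ∈ Finset.Ico (a + 1) (k + 1), U j + ∑ j ∈ Finset.Ico k b, U j <
      ∑ j ∈ Finset.Ico a b, z j := by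
  obtain ⟨h1, h2, h3, h4, h5⟩ := hn
  have e1 := Finset.sum_Ico_succ_top (f := U) (show a + 1 ≤ k by omega)
  have e2 := Finset.sum_Ico_consecutive U (show a + 1 ≤ k by omega) h2.le
  have hlt : ∀ i, a < i → i < b → U i ≤ U k := fun i hi hi' => by
    by_cases hik : i = k
    · rw [hik]
    · exact (h3 i hi hi' hik).le
  -- All values inside (a, b) lie below both ends, so the smaller end can play the role of k in
  -- `SeqBounds.left` or `SeqBounds.right`, over the whole interval [a, b).
  rcases le_total (U b) (U a) with hab | hab
  · have h6 := sum_le_of_cnt_le (h.left h0 (h1.trans h2) hb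
      (fun i hi hi' => (hlt i hi hi').trans_lt h5) hab)
    rw [Finset.sum_Ico_succ_top (by omega)] at h6
    omega
  · have h6 := sum_le_of_cnt_le (h.right h0 (h1.trans h2) hb
      (fun i hi hi' => (hlt i hi hi').trans_lt h4) hab)
    rw [Finset.sum_eq_sum_Ico_succ_bot (by omega)] at h6
    omega

theorem isCubical_interval {n : ℕ} (u : Equiv.Perm (Fin n)) {lam rho : ℕ → ℕ}
    (hnode : ∀ k ∈ Finset.Icc 1 n, IsNode (paddedSeq u) (lam k) k (rho k) ∧ rho k ≤ n + 1) :
    IsCubical (bruhatIntervalPolytope (addTail u) (addTail u * sDown n))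
      (fun k : Finset.Icc 1 n => initVec n k - initVec n (lam k))
      (fun k : Finset.Icc 1 n => initVec n (rho k) - initVec n k)
      (fun k => ((∑ j ∈ Finset.Ico (lam k + 1) (k + 1), paddedSeq u j + (k - lam k) : ℕ) : ℝ))
      (fun k => ((∑ j ∈ Finset.Ico (k : ℕ) (rho k), paddedSeq u j + (rho k - k) : ℕ) : ℝ)) := by
  have h0 := paddedSeq_le_zero u
  have hz : ∀ p ∈ permPoint '' {z | BruhatLE (addTail u) z ∧ BruhatLE z (addTail u * sDown n)},
      ∃ z, SeqBounds n (paddedSeq u) (oneLine z) ∧ p = permPoint z := by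
    rintro _ ⟨z, hz, rfl⟩
    exact ⟨z, (mem_interval_iff u z).1 hz, rfl⟩
  refine ⟨fun p hp k => ?_, fun p hp k => ?_, fun p hp k h1 h2 => ?_, fun S => ?_,
    fun p hp q hq => (sum_eq_of_mem_convexHull hp).trans (sum_eq_of_mem_convexHull hq).symm,
    fun x => ?_⟩
  · obtain ⟨hn, hb⟩ := hnode k k.2
    refine le_dotProduct_of_mem_convexHull (fun p hp => ?_) p hp
    obtain ⟨z, hz, rfl⟩ := hz p hp
    rw [initVec_sub_dotProduct_permPoint z hn.1.le (hn.2.1.le.trans hb), Nat.cast_le]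
    exact Nat.add_le_add_right (sum_le_of_cnt_le (hz.left h0 hn.1 (hn.2.1.le.trans hb)
      (fun i hi hi' => hn.2.2.1 i hi (hi'.trans hn.2.1) hi'.ne) hn.2.2.2.1.le)) _
  · obtain ⟨hn, hb⟩ := hnode k k.2
    refine le_dotProduct_of_mem_convexHull (fun p hp => ?_) p hp
    obtain ⟨z, hz, rfl⟩ := hz p hp
    rw [initVec_sub_dotProduct_permPoint z hn.2.1.le hb, Nat.cast_le]
    exact Nat.add_le_add_right (sum_le_of_cnt_le (hz.right h0 hn.2.1 hb
      (fun i hi hi' => hn.2.2.1 i (hn.1.trans hi) hi' hi.ne') hn.2.2.2.2.le)) _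
  · obtain ⟨hn, hb⟩ := hnode k k.2
    -- The gap of 1 between integers for permutations is a linear inequality, so it persists on the
    -- convex hull and excludes two equalities at any point.
    have h3 : ((∑ j ∈ Finset.Ico (lam k + 1) (k + 1), paddedSeq u j +
        ∑ j ∈ Finset.Ico (k : ℕ) (rho k), paddedSeq u j + 1 + (rho k - lam k) : ℕ) : ℝ) ≤
        (initVec n (rho k) - initVec n (lam k)) ⬝ᵥ p := by
      refine le_dotProduct_of_mem_convexHull (fun p hp => ?_) p hp
      obtain ⟨z, hz, rfl⟩ := hz p hp
      rw [initVec_sub_dotProduct_permPoint z (hn.1.trans hn.2.1).le hb, Nat.cast_le]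
      exact Nat.add_le_add_right (hz.lt_sum h0 hn hb) _
    have h4 : initVec n (rho k) - initVec n (lam k) =
        (initVec n k - initVec n (lam k)) + (initVec n (rho k) - initVec n k) := by abel
    rw [h4, add_dotProduct, h1, h2, ← Nat.cast_add, Nat.cast_le] at h3
    have := hn.1
    have := hn.2.1
    omega
  · obtain ⟨z, hz, hS⟩ := exists_mem_interval u (Subtype.val '' S)
    refine ⟨permPoint z, subset_convexHull ℝ _ ⟨z, (mem_interval_iff u z).2 hz, rfl⟩,
      fun k hk => ?_, fun k hk => ?_⟩
    · obtain ⟨hn, hb⟩ := hnode k k.2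
      have h1 := (hS _ _ _ hn hb).1 ⟨k, hk, rfl⟩
      rw [initVec_sub_dotProduct_permPoint z hn.1.le (hn.2.1.le.trans hb),
        le_antisymm (sum_le_of_cnt_le fun p => (h1 p).le) (sum_le_of_cnt_le fun p => (h1 p).ge)]
    · obtain ⟨hn, hb⟩ := hnode k k.2
      have h1 := (hS _ _ _ hn hb).2 (by
        rintro ⟨k', hk', hkk'⟩
        rw [Subtype.ext hkk'] at hk'
        exact hk hk')
      rw [initVec_sub_dotProduct_permPoint z hn.2.1.le hb,
        le_antisymm (sum_le_of_cnt_le fun p => (h1 p).le) (sum_le_of_cnt_le fun p => (h1 p).ge)]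
  · obtain ⟨c, rfl⟩ := exists_eq_sum_varpi x
    obtain ⟨α, β, hα, hβ, hαβ, hsum⟩ := exists_nonneg_combination
      (fun k hk => (hnode k hk).1) (Finset.Icc 1 n) subset_rfl (fun _ _ j hj _ => hj) c
    refine ⟨fun k => α k, fun k => β k, fun k => hα k, fun k => hβ k, fun k => hαβ k, ?_⟩
    rw [hsum, ← Finset.sum_coe_sort]
    simp only [map_sub, mkQ_initVec]

/-! ### The triangulation of the tree of minima -/

/-- All values of `V` strictly between `a` and `b` exceed the values at `a` and `b`. -/
def IsChord (V : ℕ → ℤ) (a b : ℕ) : Prop :=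
  a < b ∧ ∀ i, a < i → i < b → V a < V i ∧ V b < V i

/-- A chord cannot pass over the position of the minimum unless both its ends lie below the minimum,
which makes it the base edge; every other chord lies in one of the two subpolygons. -/
theorem mem_treeEdges_minTree (V : ℕ → ℤ) (l : List ℕ) (hl : l.Nodup) (off : ℕ)
    (hV : ∀ i j (hi : i < l.length) (hj : j < l.length), l[i] < l[j] →
      V (off + 1 + i) < V (off + 1 + j))
    (hs : ∀ i, off < i → i < off + l.length + 1 → V off < V i ∧ V (off + l.length + 1) < V i)
    (a b : ℕ) :
    (a, b) ∈ treeEdges (minTree l) off ↔ off ≤ a ∧ b ≤ off + l.length + 1 ∧ IsChord V a b := by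
  induction hd : l.length using Nat.strong_induction_on generalizing l off with
  | _ d ih =>
    subst hd
    by_cases h : l = []
    · subst h
      rw [minTree, dif_pos rfl]
      simp only [treeEdges, Finset.mem_singleton, Prod.mk.injEq, List.length_nil]
      constructor
      · rintro ⟨rfl, rfl⟩
        exact ⟨le_rfl, le_rfl, by omega, fun i _ _ => by omega⟩
      · rintro ⟨h1, h2, h3, -⟩
        omega
    · have hm := List.min_mem h
      have hc := List.idxOf_lt_length_of_mem hm
      have hcm : l[l.idxOf (l.min h)] = l.min h := List.getElem_idxOf hc
      rw [minTree, dif_neg h]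
      set c := l.idxOf (l.min h) with hcdef
      have hmin : ∀ i, off < i → i < off + l.length + 1 → i ≠ off + c + 1 →
          V (off + c + 1) < V i := by
        intro i h1 h2 h3
        have hi : i - off - 1 < l.length := by omega
        have hle : l[c] ≤ l[i - off - 1] := by
          rw [hcm]
          exact List.min_le_of_mem (List.getElem_mem hi)
        have hne : l[c] ≠ l[i - off - 1] := fun he => by
          have := (hl.getElem_inj_iff).1 he
          omega
        have := hV c (i - off - 1) hc hi (lt_of_le_of_ne hle hne)
        rwa [show off + 1 + c = off + c + 1 by omega,
          show off + 1 + (i - off - 1) = i by omega] at this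
      have hlen₁ : (l.take c).length = c := by simp only [List.length_take]; omega
      have hlen₂ : (l.drop (c + 1)).length = l.length - (c + 1) := List.length_drop
      have hL := ih _ (by omega) (l.take c) (hl.sublist (List.take_sublist _ _)) off
        (fun i j hi hj hij => by
          rw [List.getElem_take, List.getElem_take] at hij
          exact hV i j _ _ hij)
        (fun i h1 h2 => by
          rw [hlen₁] at h2 ⊢
          exact ⟨(hs i h1 (by omega)).1, hmin i h1 (by omega) (by omega)⟩) rfl
      have hR := ih _ (by omega) (l.drop (c + 1)) (hl.sublist (List.drop_sublist _ _)) (off + c + 1)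
        (fun i j hi hj hij => by
          rw [List.getElem_drop, List.getElem_drop] at hij
          have := hV _ _ _ _ hij
          rwa [show off + 1 + (c + 1 + i) = off + c + 1 + 1 + i by omega,
            show off + 1 + (c + 1 + j) = off + c + 1 + 1 + j by omega] at this)
        (fun i h1 h2 => by
          rw [hlen₂] at h2 ⊢
          rw [show off + c + 1 + (l.length - (c + 1)) + 1 = off + l.length + 1 by omega] at h2 ⊢
          exact ⟨hmin i (by omega) h2 (by omega), (hs i (by omega) h2).2⟩) rfl
      simp only [treeEdges, Finset.mem_insert, Finset.mem_union, Prod.mk.injEq, numNodes_minTree]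
      rw [hlen₁] at hL ⊢
      rw [hL, hR, hlen₂,
        show off + c + 1 + (l.length - (c + 1)) + 1 = off + l.length + 1 by omega,
        show off + (c + (l.length - (c + 1)) + 1) + 1 = off + l.length + 1 by omega]
      constructor
      · rintro (⟨rfl, rfl⟩ | ⟨h1, h2, h3⟩ | ⟨h1, h2, h3⟩)
        · exact ⟨le_rfl, le_rfl, by omega, hs⟩
        · exact ⟨h1, by omega, h3⟩
        · exact ⟨by omega, h2, h3⟩
      · rintro ⟨h1, h2, h3⟩
        by_cases h4 : b ≤ off + c + 1
        · exact Or.inr (Or.inl ⟨h1, h4, h3⟩)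
        by_cases h5 : off + c + 1 ≤ a
        · exact Or.inr (Or.inr ⟨h5, h2, h3⟩)
        have h6 := h3.2 (off + c + 1) (by omega) (by omega)
        refine Or.inl ⟨?_, ?_⟩
        · by_contra h7
          have := hmin a (by omega) (by omega) (by omega)
          omega
        · by_contra h7
          have := hmin b (by omega) (by omega) (by omega)
          omega

namespace Triangulation

variable {n : ℕ} {T : Triangulation n}

theorem Reached.mem_edges {a b : ℕ} (h : T.Reached a b) : (a, b) ∈ T.edges := by
  cases h with
  | root => exact T.distinguished_mem
  | left _ h => exact h.2.2.1
  | right _ h => exact h.2.2.2.1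

/-- Descend from the distinguished edge, keeping the given edge inside the current one. The apex is
the position of the minimum of `V` in between, which the given edge cannot pass over. -/
theorem reached_of_mem_edges {V : ℕ → ℤ}
    (hT : ∀ a b, (a, b) ∈ T.edges ↔ b ≤ n + 1 ∧ IsChord V a b)
    (hV : Set.InjOn V (Set.Ioo 0 (n + 1))) {a b : ℕ} (h : (a, b) ∈ T.edges) : T.Reached a b := by
  suffices H : ∀ d x y, y - x = d → T.Reached x y → x ≤ a → b ≤ y → T.Reached a b from
    H _ _ _ rfl .root (Nat.zero_le _) ((hT a b).1 h).1
  intro d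
  induction d using Nat.strong_induction_on with
  | _ d ih =>
    intro x y hd hxy hxa hby
    obtain ⟨hy, hlt, hch⟩ := (hT x y).1 hxy.mem_edges
    obtain ⟨-, hlt', hch'⟩ := (hT a b).1 h
    by_cases heq : x = a ∧ y = b
    · rw [← heq.1, ← heq.2]; exact hxy
    obtain ⟨c, hc, hmin⟩ := Finset.exists_min_image (Finset.Ioo x y) V
      ⟨x + 1, Finset.mem_Ioo.2 (by omega)⟩
    rw [Finset.mem_Ioo] at hc
    have hmin' : ∀ i, x < i → i < y → i ≠ c → V c < V i := fun i h1 h2 h3 =>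
      lt_of_le_of_ne (hmin i (Finset.mem_Ioo.2 ⟨h1, h2⟩)) fun h4 =>
        h3 (hV ⟨by omega, by omega⟩ ⟨by omega, by omega⟩ h4.symm)
    have htri : T.IsTriangle x c y := ⟨hc.1, hc.2,
      (hT x c).2 ⟨by omega, hc.1, fun i h1 h2 =>
        ⟨(hch i h1 (by omega)).1, hmin' i h1 (by omega) h2.ne⟩⟩,
      (hT c y).2 ⟨hy, hc.2, fun i h1 h2 =>
        ⟨hmin' i (by omega) h2 h1.ne', (hch i (by omega) h2).2⟩⟩, hxy.mem_edges⟩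
    by_cases h1 : b ≤ c
    · exact ih (c - x) (by omega) x c rfl (hxy.left htri) hxa h1
    by_cases h2 : c ≤ a
    · exact ih (y - c) (by omega) c y rfl (hxy.right htri) h2 hby
    exfalso
    have h3 := hch' c (by omega) (by omega)
    rcases hxa.lt_or_eq with h4 | h4
    · have := hmin' a h4 (by omega) (by omega)
      omega
    · have := hmin' b (by omega) (by omega) (by omega)
      omega

theorem nbr_eq {V : ℕ → ℤ}
    (hT : ∀ a b, (a, b) ∈ T.edges ↔ b ≤ n + 1 ∧ IsChord V a b)
    (hV : Set.InjOn V (Set.Ioo 0 (n + 1))) {a k b : ℕ} (hak : a < k) (hkb : k < b)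
    (hb : b ≤ n + 1) (hk : ∀ i, a < i → i < b → i ≠ k → V k < V i) (hVa : V a < V k)
    (hVb : V b < V k) : T.leftNbr k = a ∧ T.rightNbr k = b := by
  have hab : ∀ i, a < i → i < b → V a < V i ∧ V b < V i := fun i h1 h2 => by
    by_cases h3 : i = k
    · rw [h3]; exact ⟨hVa, hVb⟩
    · have := hk i h1 h2 h3
      omega
  have hchord : (a, b) ∈ T.edges := (hT a b).2 ⟨hb, hak.trans hkb, hab⟩
  have htri : T.IsTriangle a k b := ⟨hak, hkb,
    (hT a k).2 ⟨by omega, hak, fun i h1 h2 =>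
      ⟨(hab i h1 (by omega)).1, hk i h1 (by omega) h2.ne⟩⟩,
    (hT k b).2 ⟨hb, hkb, fun i h1 h2 =>
      ⟨hk i (by omega) h2 h1.ne', (hab i (by omega) h2).2⟩⟩, hchord⟩
  have hreach := reached_of_mem_edges hT hV hchord
  -- The middle vertex exceeds both outer ones in `V`, while its two sides pass only over larger
  -- values; so the outer vertices are the nearest smaller positions, and the infima below are over
  -- singletons.
  have huniq : ∀ x y, T.IsTriangle x k y → x = a ∧ y = b := by
    rintro x y ⟨h1, h2, h3, h4, h5⟩
    have h6 := ((hT x y).1 h5).2.2 k h1 h2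
    constructor
    · rcases lt_trichotomy x a with h | h | h
      · have := ((hT x k).1 h3).2.2 a h hak
        omega
      · exact h
      · have := hk x h (by omega) (by omega)
        omega
    · rcases lt_trichotomy y b with h | h | h
      · have := hk y (by omega) h (by omega)
        omega
      · exact h
      · have := ((hT k y).1 h4).2.2 b hkb h
        omega
  constructor
  · have : {x | T.IsLeftEdge x k} = {a} := by
      ext x
      refine ⟨fun ⟨y, _, h⟩ => (huniq x y h).1, ?_⟩
      rintro rfl
      exact ⟨b, hreach, htri⟩
    rw [leftNbr, this, csInf_singleton]
  · have : {y | T.IsRightEdge k y} = {b} := by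
      ext y
      refine ⟨fun ⟨x, _, h⟩ => (huniq x y h).2, ?_⟩
      rintro rfl
      exact ⟨a, hreach, htri⟩
    rw [rightNbr, this, csInf_singleton]

end Triangulation

theorem mem_psi_edges {n : ℕ} (u : Equiv.Perm (Fin n)) (a b : ℕ) :
    (a, b) ∈ (psi (longest n * u * longest n)).edges ↔
      b ≤ n + 1 ∧ IsChord (fun j => -(paddedSeq u (n + 1 - j) : ℤ)) a b := by
  set w := longest n * u * longest n with hw
  set l := List.ofFn fun i => (w i : ℕ) with hl
  have hlen : l.length = n := List.length_ofFn
  have hnodup : l.Nodup := List.nodup_ofFn.2 (Fin.val_injective.comp w.injective)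
  have key := mem_treeEdges_minTree (fun j => -(paddedSeq u (n + 1 - j) : ℤ)) l hnodup 0 ?_ ?_ a b
  · rw [hlen, zero_add] at key
    change (a, b) ∈ treeEdges (minTree l) 0 ↔ _
    rw [key]
    simp
  · intro i j hi hj hij
    rw [hlen] at hi hj
    simp only [hl, List.getElem_ofFn, hw, longest, Equiv.Perm.mul_apply, Fin.revPerm_apply,
      Fin.val_rev] at hij
    simp only [neg_lt_neg_iff, Nat.cast_lt]
    rw [paddedSeq, paddedSeq, dif_pos (by omega), dif_pos (by omega)]
    have h1 : (⟨n + 1 - (0 + 1 + i) - 1, by omega⟩ : Fin n) = Fin.rev ⟨i, hi⟩ :=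
      Fin.ext (by simp only [Fin.val_rev]; omega)
    have h2 : (⟨n + 1 - (0 + 1 + j) - 1, by omega⟩ : Fin n) = Fin.rev ⟨j, hj⟩ :=
      Fin.ext (by simp only [Fin.val_rev]; omega)
    rw [h1, h2]
    omega
  · intro i h1 h2
    rw [hlen] at h2 ⊢
    have h3 := paddedSeq_lt u (j := n + 1 - i) (by omega) (by omega)
    have h4 := paddedSeq_of_not u (j := n + 1 - 0) (by omega)
    have h5 := paddedSeq_of_not u (j := n + 1 - (0 + n + 1)) (by omega)
    simp only [neg_lt_neg_iff, Nat.cast_lt, h4, h5]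
    exact ⟨h3, h3⟩

/-- The value n at positions 0 and n+1 guarantees a larger entry on both sides; injectivity makes
the inequalities between the nearest ones strict. -/
theorem exists_isNode {n : ℕ} (u : Equiv.Perm (Fin n)) {k : ℕ} (hk : k ∈ Finset.Icc 1 n) :
    ∃ x : ℕ × ℕ, IsNode (paddedSeq u) x.1 k x.2 ∧ x.2 ≤ n + 1 := by
  classical
  rw [Finset.mem_Icc] at hk
  set U := paddedSeq u with hU
  have hkn : U k < n := paddedSeq_lt u hk.1 hk.2
  have h0 : U 0 = n := paddedSeq_of_not u (by omega)
  have hn : U (n + 1) = n := paddedSeq_of_not u (by omega)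
  have hex : ∃ b, k < b ∧ U k < U b := ⟨n + 1, by omega, by omega⟩
  set a := Nat.findGreatest (fun a => U k < U a) (k - 1) with ha
  have ha1 : U k < U a :=
    Nat.findGreatest_spec (P := fun a => U k < U a) (Nat.zero_le (k - 1)) (by omega)
  have ha2 : a ≤ k - 1 := Nat.findGreatest_le _
  have hb1 := Nat.find_spec hex
  have hb2 : Nat.find hex ≤ n + 1 := Nat.find_min' hex ⟨by omega, by omega⟩
  refine ⟨(a, Nat.find hex), ⟨by dsimp only; omega, hb1.1, fun i h1 h2 h3 => ?_, ha1, hb1.2⟩, hb2⟩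
  dsimp only at h1 h2
  refine lt_of_le_of_ne ?_ fun h4 =>
    h3 (paddedSeq_inj u (by omega) (by omega) hk.1 hk.2 h4)
  rcases lt_or_gt_of_ne h3 with h4 | h4
  · exact not_lt.1
      (Nat.findGreatest_is_greatest (P := fun a => U k < U a) (n := k - 1) h1 (by omega))
  · exact not_lt.1 fun h5 => Nat.find_min hex h2 ⟨h4, h5⟩

theorem psi_nbr {n : ℕ} (u : Equiv.Perm (Fin n)) {a k b : ℕ} (hn : IsNode (paddedSeq u) a k b)
    (hb : b ≤ n + 1) :
    (psi (longest n * u * longest n)).leftNbr (n + 1 - k) = n + 1 - b ∧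
      (psi (longest n * u * longest n)).rightNbr (n + 1 - k) = n + 1 - a := by
  obtain ⟨h1, h2, h3, h4, h5⟩ := hn
  refine Triangulation.nbr_eq (mem_psi_edges u) ?_ (by omega) (by omega) (by omega) ?_ ?_ ?_
  · intro i hi j hj hij
    have h6 := hi.1; have h7 := hi.2; have h8 := hj.1; have h9 := hj.2
    have := paddedSeq_inj u (i := n + 1 - i) (j := n + 1 - j) (by omega) (by omega) (by omega)
      (by omega) (by simpa using hij)
    omega
  · intro i h6 h7 h8
    simp only [neg_lt_neg_iff, Nat.cast_lt]
    rw [show n + 1 - (n + 1 - k) = k by omega]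
    exact h3 _ (by omega) (by omega) (by omega)
  · simp only [neg_lt_neg_iff, Nat.cast_lt]
    rwa [show n + 1 - (n + 1 - k) = k by omega, show n + 1 - (n + 1 - b) = b by omega]
  · simp only [neg_lt_neg_iff, Nat.cast_lt]
    rwa [show n + 1 - (n + 1 - k) = k by omega, show n + 1 - (n + 1 - a) = a by omega]

/-! ### The isomorphism of fans -/

/-- The automorphism `x ↦ -(x_{n+1}, …, x_1)` of `ℝ^{n+1}`. -/
noncomputable def negRev (n : ℕ) : (Fin (n + 1) → ℝ) ≃ₗ[ℝ] (Fin (n + 1) → ℝ) :=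
  (LinearEquiv.funCongrLeft ℝ ℝ Fin.revPerm).trans (LinearEquiv.neg ℝ)

theorem negRev_apply {n : ℕ} (x : Fin (n + 1) → ℝ) (j : Fin (n + 1)) :
    negRev n x j = -x j.rev := rfl

theorem map_negRev_diagonalLine (n : ℕ) :
    (diagonalLine n).map (negRev n : (Fin (n + 1) → ℝ) →ₗ[ℝ] _) = diagonalLine n := by
  have h : negRev n (fun _ => 1) = -fun _ => 1 := rfl
  rw [diagonalLine, Submodule.map_span, Set.image_singleton, LinearEquiv.coe_coe, h,
    ← Set.neg_singleton, Submodule.span_neg]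

/-- The automorphism of `N ⊗ ℝ` induced by `negRev`. -/
noncomputable def negRevN (n : ℕ) : NReal n ≃ₗ[ℝ] NReal n :=
  Submodule.Quotient.equiv _ _ (negRev n) (map_negRev_diagonalLine n)

theorem negRevN_mkQ {n : ℕ} (x : Fin (n + 1) → ℝ) :
    negRevN n ((diagonalLine n).mkQ x) = (diagonalLine n).mkQ (negRev n x) := rfl

theorem negRevN_varpi {n i : ℕ} (hi : i ≤ n + 1) :
    negRevN n (varpi n i) = varpi n (n + 1 - i) := by
  rw [← mkQ_initVec, ← mkQ_initVec, negRevN_mkQ, Submodule.mkQ_apply, Submodule.mkQ_apply,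
    Submodule.Quotient.eq, diagonalLine, Submodule.mem_span_singleton]
  -- Minus the indicator of the last i coordinates is the indicator of the first n+1-i minus the
  -- all-ones vector.
  refine ⟨-1, ?_⟩
  ext j
  have hj := j.2
  simp only [Pi.smul_apply, Pi.sub_apply, negRev_apply, initVec, Fin.val_rev]
  split_ifs <;> first | omega | norm_num

theorem negRevN_involutive {n : ℕ} (x : NReal n) : negRevN n (negRevN n x) = x := by
  obtain ⟨y, rfl⟩ := (diagonalLine n).mkQ_surjective x
  rw [negRevN_mkQ, negRevN_mkQ]
  congr 1
  ext j
  simp [negRev_apply]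

theorem negRevN_mem_latticeN {n : ℕ} {x : NReal n} (hx : x ∈ latticeN n) :
    negRevN n x ∈ latticeN n := by
  obtain ⟨_, ⟨m, rfl⟩, rfl⟩ := hx
  refine ⟨_, ⟨fun j => -m j.rev, rfl⟩, ?_⟩
  change (diagonalLine n).mkQ _ = negRevN n ((diagonalLine n).mkQ _)
  rw [negRevN_mkQ]
  congr 1
  ext j
  simp [negRev_apply]

theorem map_negRevN_latticeN (n : ℕ) :
    (latticeN n).map (negRevN n : NReal n →ₗ[ℝ] NReal n).toAddMonoidHom = latticeN n := by
  apply le_antisymm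
  · rintro _ ⟨x, hx, rfl⟩
    exact negRevN_mem_latticeN hx
  · intro x hx
    exact ⟨negRevN n x, negRevN_mem_latticeN hx, negRevN_involutive x⟩

theorem map_hull {V W : Type} [AddCommGroup V] [Module ℝ V] [AddCommGroup W] [Module ℝ W]
    (f : V →ₗ[ℝ] W) (Q : Set V) :
    PointedCone.map f (PointedCone.hull ℝ Q) = PointedCone.hull ℝ (f '' Q) := by
  rw [PointedCone.map, PointedCone.hull, Submodule.map_span]
  rfl

end CatalanFan

open CatalanFan in
theorem theorem6p5 (n : ℕ) (u : Equiv.Perm (Fin n)) :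
    CatalanFan.FanIsomorphic
      (CatalanFan.latticeN n)
      (CatalanFan.normalFan
        (CatalanFan.bruhatIntervalPolytope
          (CatalanFan.addTail u) (CatalanFan.addTail u * CatalanFan.sDown n)))
      (CatalanFan.latticeN n)
      (CatalanFan.psi (CatalanFan.longest n * u * CatalanFan.longest n)).fan := by
  -- Neighbours are chosen for all k at once; outside 1, ..., n the pair is a dummy.
  have hex : ∀ k, ∃ x : ℕ × ℕ, k ∈ Finset.Icc 1 n →
      IsNode (paddedSeq u) x.1 k x.2 ∧ x.2 ≤ n + 1 := fun k => by
    by_cases hk : k ∈ Finset.Icc 1 n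
    · obtain ⟨x, hx⟩ := exists_isNode u hk
      exact ⟨x, fun _ => hx⟩
    · exact ⟨0, fun h => absurd h hk⟩
  choose x hx using hex
  have hfan := (isCubical_interval u (lam := fun k => (x k).1) (rho := fun k => (x k).2)
    hx).normalFan_eq
  set T := psi (longest n * u * longest n) with hT
  simp only [map_sub, mkQ_initVec] at hfan
  have hv : ∀ k ∈ Finset.Icc 1 n,
      negRevN n (varpi n k - varpi n (x k).1) = T.vVec (n + 1 - k) := fun k hk => by
    obtain ⟨hn, hb⟩ := hx k hk
    have h1 := hn.1
    have h2 := hn.2.1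
    rw [Triangulation.vVec, (psi_nbr u hn hb).2, map_sub, negRevN_varpi (by omega),
      negRevN_varpi (by omega)]
  have hw : ∀ k ∈ Finset.Icc 1 n,
      negRevN n (varpi n (x k).2 - varpi n k) = T.wVec (n + 1 - k) := fun k hk => by
    obtain ⟨hn, hb⟩ := hx k hk
    have h2 := hn.2.1
    rw [Triangulation.wVec, (psi_nbr u hn hb).1, map_sub, negRevN_varpi (by omega),
      negRevN_varpi (by omega)]
  have hflip : ∀ k ∈ Finset.Icc 1 n, n + 1 - k ∈ Finset.Icc 1 n ∧ n + 1 - (n + 1 - k) = k :=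
    fun k hk => by rw [Finset.mem_Icc] at *; omega
  have hmem : ∀ (y : NReal n) (Q : Set (NReal n)), negRevN n y ∈ negRevN n '' Q ↔ y ∈ Q :=
    fun y Q => (negRevN n).injective.mem_set_image
  refine ⟨negRevN n, map_negRevN_latticeN n, ?_⟩
  have himage : PointedCone.map (negRevN n : NReal n →ₗ[ℝ] NReal n) ''
      normalFan (bruhatIntervalPolytope (addTail u) (addTail u * sDown n)) = T.fan := by
    rw [hfan]
    ext σ
    constructor
    · rintro ⟨_, ⟨Q, h1, h2, rfl⟩, rfl⟩
      refine ⟨negRevN n '' Q, ?_, ?_, map_hull _ _⟩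
      · rintro _ ⟨y, hy, rfl⟩
        obtain ⟨k, rfl | rfl⟩ := h1 y hy
        · exact ⟨n + 1 - k, (hflip k k.2).1, Or.inl (hv k k.2)⟩
        · exact ⟨n + 1 - k, (hflip k k.2).1, Or.inr (hw k k.2)⟩
      · intro i hi
        obtain ⟨h3, h4⟩ := hflip i hi
        have := h2 ⟨_, h3⟩
        rwa [← hmem, ← hmem _ Q, hv _ h3, hw _ h3, h4] at this
    · rintro ⟨Q, h1, h2, rfl⟩
      have himg : negRevN n '' (negRevN n '' Q) = Q := by
        rw [Set.image_image]
        simp only [negRevN_involutive, Set.image_id']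
      refine ⟨_, ⟨negRevN n '' Q, ?_, ?_, rfl⟩, ?_⟩
      · rintro _ ⟨y, hy, rfl⟩
        obtain ⟨k, hk, rfl | rfl⟩ := h1 y hy
        · refine ⟨⟨_, (hflip k hk).1⟩, Or.inl ?_⟩
          rw [← negRevN_involutive (varpi n _ - _), hv _ (hflip k hk).1, (hflip k hk).2]
        · refine ⟨⟨_, (hflip k hk).1⟩, Or.inr ?_⟩
          rw [← negRevN_involutive (varpi n _ - _), hw _ (hflip k hk).1, (hflip k hk).2]
      · intro k
        rw [← hmem, ← hmem (_ - varpi n k), himg, hv _ k.2, hw _ k.2]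
        exact h2 _ (hflip k k.2).1
      · rw [map_hull]
        exact congrArg _ himg
  rw [← himage]
  -- With the image of the fan identified, bijectivity only needs that an injective linear map is
  -- injective on cones.
  exact (Submodule.map_injective_of_injective
    (f := (negRevN n : NReal n →ₗ[ℝ] NReal n).restrictScalars {c : ℝ // 0 ≤ c}) (negRevN n).injective).injOn.bijOn_image
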